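/- A POVM on $\mathbb{C}^d$ is a finite family $\mathrm{M}=(M_i)_{i\in I}$ of positive semidefinite operators on $\mathbb{C}^d$ with $\sum_{i\in I} M_i=\mathrm{Id}$. For a Hermitian operator $\Delta$ on $\mathbb{C}^d$ put $\|\Delta\|_{\mathrm{M}}=\sum_{i\in I}|\mathrm{tr}(M_i\Delta)|$, and for a set $\mathbf{M}$ of POVMs on $\mathbb{C}^d$ put $\|\Delta\|_{\mathbf{M}}=\sup_{\mathrm{M}\in\mathbf{M}}\|\Delta\|_{\mathrm{M}}$ (with the supremum of the empty set equal to $0$). Let $\mathbf{ALL}$ be the set of all POVMs on $\mathbb{C}^d$; the norm $\|\cdot\|_{\mathbf{ALL}}$ is the trace norm $\|\cdot\|_1$ on Hermitian operators. Theorem. There are positive constants $c,C$ such that the following holds. (i) For any dimension $d\ge 1$ and any $0<\varepsilon<1$, there is a family $\mathbf{M}$ consisting of at most $\exp(C|\log\varepsilon|\,d^2)$ POVMs on $\mathbb{C}^d$ such that $\|\Delta\|_{\mathbf{M}}\ge(1-\varepsilon)\|\Delta\|_{\mathbf{ALL}}$ for every Hermitian operator $\Delta$ on $\mathbb{C}^d$.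 (ii) For any dimension $d\ge 1$ and any $\varepsilon>C/\sqrt d$, any family $\mathbf{M}$ of POVMs on $\mathbb{C}^d$ such that $\|\Delta\|_{\mathbf{M}}\ge\varepsilon\|\Delta\|_{\mathbf{ALL}}$ for every Hermitian operator $\Delta$ on $\mathbb{C}^d$ contains at least $\exp(c\,\varepsilon^2d^2)$ POVMs. -/

import Mathlib

open scoped ComplexOrder

/-- A POVM on `ℂ^d`: a finite family of positive (semidefinite) operators summing to the identity.
The finite outcome set is enumerated as `Fin n`. -/
structure POVM (d : ℕ) where
  /-- the number of outcomes -/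
  n : ℕ
  /-- the operators of the family -/
  op : Fin n → Matrix (Fin d) (Fin d) ℂ
  posSemidef : ∀ i, (op i).PosSemidef
  sum_op : ∑ i, op i = 1

/-- The measurement (semi-)norm of a POVM: `‖Δ‖_M = ∑ i, |tr (M_i Δ)|`. -/
noncomputable def POVM.measNorm {d : ℕ} (M : POVM d) (Δ : Matrix (Fin d) (Fin d) ℂ) : ℝ :=
  ∑ i, ‖(M.op i * Δ).trace‖

/-- The distinguishability norm of a set of POVMs: the supremum of the measurement norms of its
members (a supremum of nonnegative numbers, so it is `0` for the empty set; it is bounded by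
`POVM.bddAbove_measNorm` below). -/
noncomputable def distNorm {d : ℕ} (S : Set (POVM d)) (Δ : Matrix (Fin d) (Fin d) ℂ) : ℝ :=
  sSup ((fun M : POVM d => M.measNorm Δ) '' S)

/-- The norm `‖·‖_ALL`: the distinguishability norm of the set of all POVMs on `ℂ^d`. -/
noncomputable def allNorm {d : ℕ} (Δ : Matrix (Fin d) (Fin d) ℂ) : ℝ :=
  distNorm (Set.univ : Set (POVM d)) Δ

/-- The trace norm of a Hermitian matrix. -/
noncomputable def hermTraceNorm {d : ℕ} {Δ : Matrix (Fin d) (Fin d) ℂ} (h : Δ.IsHermitian) : ℝ :=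
  ∑ j, |h.eigenvalues j|

/-- The rank-one projection on the `j`-th eigenvector of a Hermitian matrix. -/
noncomputable def eigProj {d : ℕ} {Δ : Matrix (Fin d) (Fin d) ℂ} (h : Δ.IsHermitian)
    (j : Fin d) : Matrix (Fin d) (Fin d) ℂ :=
  Matrix.vecMulVec (h.eigenvectorBasis j).ofLp (star (h.eigenvectorBasis j).ofLp)

theorem eigProj_posSemidef {d : ℕ} {Δ : Matrix (Fin d) (Fin d) ℂ} (h : Δ.IsHermitian)
    (j : Fin d) : (eigProj h j).PosSemidef :=
  Matrix.posSemidef_vecMulVec_self_star _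

theorem sum_eigProj {d : ℕ} {Δ : Matrix (Fin d) (Fin d) ℂ} (h : Δ.IsHermitian) :
    ∑ j, eigProj h j = 1 := by
  have hU := Unitary.coe_mul_star_self h.eigenvectorUnitary
  rw [← hU]
  ext a b
  simp [Matrix.sum_apply, eigProj, Matrix.vecMulVec_apply, Matrix.mul_apply, Matrix.star_apply]

theorem mul_eigProj {d : ℕ} {Δ : Matrix (Fin d) (Fin d) ℂ} (h : Δ.IsHermitian) (j : Fin d) :
    Δ * eigProj h j = (h.eigenvalues j : ℂ) • eigProj h j := by
  rw [eigProj, Matrix.mul_vecMulVec, h.mulVec_eigenvectorBasis j]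
  ext a b
  simp [Matrix.vecMulVec_apply, mul_assoc]

theorem trace_eigProj {d : ℕ} {Δ : Matrix (Fin d) (Fin d) ℂ} (h : Δ.IsHermitian) (j : Fin d) :
    (eigProj h j).trace = 1 := by
  have h1 := h.eigenvectorBasis.orthonormal.1 j
  have h2 : inner ℂ (h.eigenvectorBasis j) (h.eigenvectorBasis j) = (1 : ℂ) := by
    rw [inner_self_eq_norm_sq_to_K, h1]; simp
  rw [eigProj, Matrix.trace_vecMulVec, ← h2, EuclideanSpace.inner_eq_star_dotProduct]

theorem POVM.measNorm_le {d : ℕ} (M : POVM d) {Δ : Matrix (Fin d) (Fin d) ℂ}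
    (h : Δ.IsHermitian) : M.measNorm Δ ≤ hermTraceNorm h := by
  have key : ∀ i, ‖(M.op i * Δ).trace‖
      ≤ ∑ j, |h.eigenvalues j| * (M.op i * eigProj h j).trace.re := by
    intro i
    have e : (M.op i * Δ).trace
        = ∑ j, (h.eigenvalues j : ℂ) * (M.op i * eigProj h j).trace := by
      calc (M.op i * Δ).trace = (M.op i * (Δ * ∑ j, eigProj h j)).trace := by
            rw [sum_eigProj, mul_one]
        _ = _ := by simp [Finset.mul_sum, mul_eigProj, Matrix.trace_sum]
    rw [e]
    refine (norm_sum_le _ _).trans (Finset.sum_le_sum fun j _ => ?_)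
    have hp : 0 ≤ (M.op i * eigProj h j).trace := by
      rw [eigProj, Matrix.mul_vecMulVec, Matrix.trace_vecMulVec, dotProduct_comm]
      exact (M.posSemidef i).dotProduct_mulVec_nonneg _
    rw [norm_mul, ← Complex.re_eq_norm.mpr hp]
    simp
  calc M.measNorm Δ ≤ ∑ i, ∑ j, |h.eigenvalues j| * (M.op i * eigProj h j).trace.re :=
        Finset.sum_le_sum fun i _ => key i
    _ = ∑ j, |h.eigenvalues j| * ((∑ i, M.op i) * eigProj h j).trace.re := by
        rw [Finset.sum_comm]
        simp [Finset.sum_mul, Matrix.trace_sum, Finset.mul_sum]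
    _ = hermTraceNorm h := by simp [M.sum_op, trace_eigProj, hermTraceNorm]

/-- The supremum defining the distinguishability norm is a genuine one. -/
theorem POVM.bddAbove_measNorm {d : ℕ} (S : Set (POVM d)) {Δ : Matrix (Fin d) (Fin d) ℂ}
    (h : Δ.IsHermitian) : BddAbove ((fun M : POVM d => M.measNorm Δ) '' S) := by
  refine ⟨hermTraceNorm h, ?_⟩
  rintro _ ⟨M, _, rfl⟩
  exact M.measNorm_le h

/-- `‖·‖_ALL` is the trace norm on Hermitian matrices. -/
theorem allNorm_eq_hermTraceNorm {d : ℕ} {Δ : Matrix (Fin d) (Fin d) ℂ} (h : Δ.IsHermitian) :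
    allNorm Δ = hermTraceNorm h := by
  let E : POVM d := ⟨d, eigProj h, eigProj_posSemidef h, sum_eigProj h⟩
  have hE : E.measNorm Δ = hermTraceNorm h := by
    refine Finset.sum_congr rfl fun j _ => ?_
    change ‖(eigProj h j * Δ).trace‖ = _
    rw [Matrix.trace_mul_comm, mul_eigProj]
    simp [trace_eigProj]
  apply le_antisymm
  · refine csSup_le ⟨_, E, Set.mem_univ _, rfl⟩ ?_
    rintro _ ⟨M, _, rfl⟩
    exact M.measNorm_le h
  · rw [← hE]
    exact le_csSup (POVM.bddAbove_measNorm _ h) ⟨E, Set.mem_univ _, rfl⟩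

open scoped Matrix.Norms.L2Operator

/-! Part (i). Two-outcome POVMs `(V Vᴴ, 1 - V Vᴴ)` nearly suffice: the trace norm of `Δ` is attained
when `V Vᴴ` projects onto the nonnegative eigenspaces, and since everything is Lipschitz in `V`, an
operator-norm net of contractions loses only a factor `1 - ε` (`exists_net_measNorm_ge`). The size
of the net is right for `ε` away from 1. As `ε → 1` the budget `|log ε| d²` shrinks like `(1 - ε)
d²`. Then contractions with about `4 (1 - ε) d` columns are enough, since they catch the largest
eigenvalues (`exists_lowRank_net_measNorm_ge`). Once `(1 - ε) d < 1/2`, a single informationally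
complete POVM does the job (`exists_povm_measNorm_ge`).

Part (ii). The test operator is a uniformly random symmetric sign matrix. Its mean trace norm is at
least `d^(3/2) / 2`, by comparing second and fourth moments (`sum_hermTraceNorm_signMatrix_ge`). For
one fixed POVM, Cauchy–Schwarz bounds the squared measurement norm by `2 d` times a quadratic form
in the signs with norm at most 1 and trace at most `d`. Its exponential moment is therefore at most
`exp (d / 2)` (`POVM.sum_exp_measNorm_sq_le`), so one POVM typically sees only order `d`. Summing
these moments over the family, and bounding the total from below by Jensen's inequality, gives
cardinality at least `exp (ε² d² / 32 - d / 2)`. The lower bound on `ε` absorbs the second term. -/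

/-! ### Volumetric nets of contractions -/

-- Volume comparison: the balls of radius `δ / 2` around the points are disjoint and lie in the ball
-- of radius `1 + δ / 2`.
open MeasureTheory Module in
theorem card_le_of_separated_unitBall {E : Type*} [NormedAddCommGroup E] [NormedSpace ℝ E]
    [FiniteDimensional ℝ E] {δ : ℝ} (hδ : 0 < δ) (s : Finset E) (hs : ∀ c ∈ s, ‖c‖ ≤ 1)
    (h : ∀ c ∈ s, ∀ d ∈ s, c ≠ d → δ ≤ ‖c - d‖) :
    (s.card : ℝ) ≤ (1 + 2 / δ) ^ finrank ℝ E := by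
  borelize E
  let μ : Measure E := Measure.addHaar
  have D : Set.Pairwise (s : Set E) (Function.onFun Disjoint fun c => Metric.ball (c : E) (δ / 2)) := by
    rintro c hc d hd hcd
    apply Metric.ball_disjoint_ball
    rw [dist_eq_norm]
    have := h c hc d hd hcd
    linarith
  have hsub : (⋃ c ∈ s, Metric.ball (c : E) (δ / 2)) ⊆ Metric.ball (0 : E) (1 + δ / 2) := by
    refine Set.iUnion₂_subset fun x hx => ?_
    apply Metric.ball_subset_ball'
    have := hs x hx
    rw [dist_zero_right]
    linarith
  have I : (s.card : ENNReal) * ENNReal.ofReal ((δ / 2) ^ finrank ℝ E) * μ (Metric.ball 0 1) ≤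
      ENNReal.ofReal ((1 + δ / 2) ^ finrank ℝ E) * μ (Metric.ball 0 1) :=
    calc
      _ = μ (⋃ c ∈ s, Metric.ball (c : E) (δ / 2)) := by
        rw [measure_biUnion_finset D fun c _ => measurableSet_ball]
        simp only [μ.addHaar_ball_of_pos _ (half_pos hδ), Finset.sum_const, nsmul_eq_mul, mul_assoc]
      _ ≤ μ (Metric.ball (0 : E) (1 + δ / 2)) := measure_mono hsub
      _ = _ := by rw [μ.addHaar_ball_of_pos _ (by positivity)]
  have J : (s.card : ENNReal) * ENNReal.ofReal ((δ / 2) ^ finrank ℝ E)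
      ≤ ENNReal.ofReal ((1 + δ / 2) ^ finrank ℝ E) :=
    (ENNReal.mul_le_mul_iff_left (Metric.measure_ball_pos _ _ zero_lt_one).ne'
      measure_ball_lt_top.ne).1 I
  have K : (s.card : ℝ) * (δ / 2) ^ finrank ℝ E ≤ (1 + δ / 2) ^ finrank ℝ E := by
    rw [← ENNReal.ofReal_natCast, ← ENNReal.ofReal_mul (by positivity)] at J
    exact (ENNReal.ofReal_le_ofReal_iff (by positivity)).1 J
  have e : (1 + 2 / δ) = (1 + δ / 2) / (δ / 2) := by field_simp; ring
  rw [e, div_pow, le_div_iff₀ (by positivity)]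
  exact K

/-- A finite-dimensional unit ball has a `δ`-net of cardinality at most `(1 + 2 / δ) ^ dim`. -/
theorem exists_net_unitBall (E : Type*) [NormedAddCommGroup E] [NormedSpace ℝ E]
    [FiniteDimensional ℝ E] {δ : ℝ} (hδ : 0 < δ) :
    ∃ N : Finset E, (∀ c ∈ N, ‖c‖ ≤ 1) ∧ (∀ x : E, ‖x‖ ≤ 1 → ∃ c ∈ N, ‖c - x‖ ≤ δ) ∧
      (N.card : ℝ) ≤ (1 + 2 / δ) ^ Module.finrank ℝ E := by
  classical
  -- A separated set of maximal cardinality is a net: a point far from all of it could be added.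
  let p : ℕ → Prop := fun n => ∃ s : Finset E, s.card = n ∧ (∀ c ∈ s, ‖c‖ ≤ 1) ∧
    ∀ c ∈ s, ∀ d ∈ s, c ≠ d → δ ≤ ‖c - d‖
  obtain ⟨B, hB⟩ := exists_nat_ge ((1 + 2 / δ) ^ Module.finrank ℝ E)
  have hb : ∀ n, p n → n ≤ B := by
    rintro n ⟨s, rfl, h1, h2⟩
    exact_mod_cast (card_le_of_separated_unitBall hδ s h1 h2).trans hB
  have h0 : p 0 := ⟨∅, by simp⟩
  obtain ⟨s, hcard, h1, h2⟩ := Nat.findGreatest_spec (P := p) (Nat.zero_le B) h0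
  refine ⟨s, h1, fun x hx => ?_, card_le_of_separated_unitBall hδ s h1 h2⟩
  by_contra! hcon
  have hxs : x ∉ s := fun hxs => by
    have := hcon x hxs
    simp at this
    linarith
  have : p (Nat.findGreatest p B + 1) := by
    refine ⟨insert x s, by rw [Finset.card_insert_of_notMem hxs, hcard], ?_, ?_⟩
    · intro c hc
      rcases Finset.mem_insert.1 hc with rfl | hc
      exacts [hx, h1 c hc]
    · intro c hc d hd hcd
      rcases Finset.mem_insert.1 hc with hc' | hc' <;> rcases Finset.mem_insert.1 hd with hd' | hd'
      · exact absurd (hc'.trans hd'.symm) hcd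
      · rw [norm_sub_rev, hc']; exact (hcon d hd').le
      · rw [hd']; exact (hcon c hc').le
      · exact h2 c hc' d hd' hcd
  exact absurd (Nat.le_findGreatest (hb _ this) this) (by simp)

/-- The exponent is the real dimension. Its linear growth in `k` is what makes low-rank nets cheap.
-/
theorem exists_net_matrix (d k : ℕ) {δ : ℝ} (hδ : 0 < δ) :
    ∃ N : Finset (Matrix (Fin d) (Fin k) ℂ), (∀ V ∈ N, ‖V‖ ≤ 1) ∧
      (∀ W : Matrix (Fin d) (Fin k) ℂ, ‖W‖ ≤ 1 → ∃ V ∈ N, ‖V - W‖ ≤ δ) ∧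
      (N.card : ℝ) ≤ (1 + 2 / δ) ^ (2 * (d * k)) := by
  have : FiniteDimensional ℝ (Matrix (Fin d) (Fin k) ℂ) :=
    FiniteDimensional.complexToReal _
  obtain ⟨N, h1, h2, h3⟩ := exists_net_unitBall (Matrix (Fin d) (Fin k) ℂ) hδ
  refine ⟨N, h1, h2, ?_⟩
  have : Module.finrank ℝ (Matrix (Fin d) (Fin k) ℂ) = 2 * (d * k) := by
    rw [finrank_real_of_complex, Module.finrank_matrix]; simp
  rwa [this] at h3

/-! ### Weights of a contraction along an orthonormal basis -/

/-- The squared length of `Vᴴ x`. -/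
noncomputable def rangeWeight {d k : ℕ} (V : Matrix (Fin d) (Fin k) ℂ)
    (x : EuclideanSpace ℂ (Fin d)) : ℝ :=
  ‖WithLp.toLp 2 (V.conjTranspose.mulVec x.ofLp)‖ ^ 2

theorem rangeWeight_nonneg {d k : ℕ} (V : Matrix (Fin d) (Fin k) ℂ)
    (x : EuclideanSpace ℂ (Fin d)) : 0 ≤ rangeWeight V x := sq_nonneg _

theorem norm_conjTranspose_mulVec_le {d k : ℕ} (V : Matrix (Fin d) (Fin k) ℂ)
    (x : EuclideanSpace ℂ (Fin d)) :
    ‖WithLp.toLp 2 (V.conjTranspose.mulVec x.ofLp)‖ ≤ ‖V‖ * ‖x‖ := by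
  have := Matrix.l2_opNorm_mulVec V.conjTranspose x
  rwa [Matrix.l2_opNorm_conjTranspose] at this


theorem star_dotProduct_mul_conjTranspose {d k : ℕ} (V : Matrix (Fin d) (Fin k) ℂ)
    (x : Fin d → ℂ) :
    star x ⬝ᵥ (V * V.conjTranspose).mulVec x = (rangeWeight V (WithLp.toLp 2 x) : ℂ) := by
  rw [rangeWeight, ← Matrix.mulVec_mulVec, Matrix.dotProduct_mulVec,
    ← Matrix.conjTranspose_conjTranspose V, ← Matrix.star_mulVec]
  simp [EuclideanSpace.norm_sq_eq, dotProduct, Complex.conj_mul']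

theorem abs_rangeWeight_sub_le {d k : ℕ} {V W : Matrix (Fin d) (Fin k) ℂ} (hV : ‖V‖ ≤ 1)
    (hW : ‖W‖ ≤ 1) {x : EuclideanSpace ℂ (Fin d)} (hx : ‖x‖ = 1) :
    |rangeWeight V x - rangeWeight W x| ≤ 2 * ‖V - W‖ := by
  have h1 := norm_conjTranspose_mulVec_le V x
  have h2 := norm_conjTranspose_mulVec_le W x
  have h3 := norm_conjTranspose_mulVec_le (V - W) x
  rw [Matrix.conjTranspose_sub, Matrix.sub_mulVec, WithLp.toLp_sub] at h3
  rw [hx, mul_one] at h1 h2 h3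
  have h4 := (abs_norm_sub_norm_le _ _).trans h3
  rw [rangeWeight, rangeWeight, sq_sub_sq, abs_mul]
  refine mul_le_mul ?_ h4 (abs_nonneg _) zero_le_two
  rw [abs_of_nonneg (by positivity)]
  linarith

/-- Where the ideal `W` has no weight, the error is quadratic in `V - W`, so `sum_rangeWeight_le`
controls its sum over many basis vectors. -/
theorem rangeWeight_eq_of_rangeWeight_eq_zero {d k : ℕ} {V W : Matrix (Fin d) (Fin k) ℂ}
    {x : EuclideanSpace ℂ (Fin d)} (hW : rangeWeight W x = 0) :
    rangeWeight V x = rangeWeight (V - W) x := by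
  rw [rangeWeight, sq_eq_zero_iff, norm_eq_zero] at hW
  rw [rangeWeight, rangeWeight, Matrix.conjTranspose_sub, Matrix.sub_mulVec, WithLp.toLp_sub, hW,
    sub_zero]

/-- The sum is the squared Hilbert–Schmidt norm of `V`, and each of the `k` columns has length at
most `‖V‖`. -/
theorem sum_rangeWeight_le {d k : ℕ} (V : Matrix (Fin d) (Fin k) ℂ)
    (u : OrthonormalBasis (Fin d) ℂ (EuclideanSpace ℂ (Fin d))) :
    ∑ i, rangeWeight V (u i) ≤ k * ‖V‖ ^ 2 := by
  have col (c : Fin k) : ∑ i, ‖V.conjTranspose.mulVec (u i).ofLp c‖ ^ 2 ≤ ‖V‖ ^ 2 := by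
    have h1 : ∀ i, V.conjTranspose.mulVec (u i).ofLp c
        = inner ℂ (WithLp.toLp 2 (V.mulVec (Pi.single c 1))) (u i) := by
      intro i
      simp [Matrix.mulVec, dotProduct, PiLp.inner_apply, mul_comm]
    simp_rw [h1]
    rw [u.sum_sq_norm_inner_left]
    have := Matrix.l2_opNorm_mulVec V (EuclideanSpace.single c (1 : ℂ))
    rw [PiLp.norm_single, norm_one, mul_one] at this
    exact pow_le_pow_left₀ (norm_nonneg _) this 2
  calc ∑ i, rangeWeight V (u i) = ∑ c, ∑ i, ‖V.conjTranspose.mulVec (u i).ofLp c‖ ^ 2 := by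
        rw [Finset.sum_comm]
        simp [rangeWeight, EuclideanSpace.norm_sq_eq]
    _ ≤ ∑ c : Fin k, ‖V‖ ^ 2 := Finset.sum_le_sum fun c _ => col c
    _ = k * ‖V‖ ^ 2 := by simp

/-- A partial isometry onto the span of a subset of an orthonormal basis. -/
theorem exists_rangeWeight_eq_indicator {d k : ℕ}
    (u : OrthonormalBasis (Fin d) ℂ (EuclideanSpace ℂ (Fin d))) {g : Fin k → Fin d}
    (hg : Function.Injective g) {E : Finset (Fin d)} (hE : ∀ i ∈ E, ∃ c, g c = i) :
    ∃ V : Matrix (Fin d) (Fin k) ℂ, ‖V‖ ≤ 1 ∧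
      ∀ i, rangeWeight V (u i) = if i ∈ E then 1 else 0 := by
  -- Columns with `g c ∉ E` are set to zero, so `E` may have fewer than `k` elements.
  let V : Matrix (Fin d) (Fin k) ℂ :=
    Matrix.of fun a c => if g c ∈ E then (u (g c)).ofLp a else 0
  have hV : ∀ (x : EuclideanSpace ℂ (Fin d)) c, V.conjTranspose.mulVec x.ofLp c
      = if g c ∈ E then inner ℂ (u (g c)) x else 0 := by
    intro x c
    by_cases h : g c ∈ E <;>
      simp [V, Matrix.mulVec, dotProduct, PiLp.inner_apply, h, mul_comm]
  refine ⟨V, ?_, fun i => ?_⟩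
  · rw [← Matrix.l2_opNorm_conjTranspose, Matrix.l2_opNorm_def]
    refine ContinuousLinearMap.opNorm_le_bound _ zero_le_one fun x => ?_
    rw [one_mul]
    change ‖WithLp.toLp 2 (V.conjTranspose.mulVec x.ofLp)‖ ≤ ‖x‖
    refine abs_le_of_sq_le_sq' ?_ (norm_nonneg _) |>.2
    rw [EuclideanSpace.norm_sq_eq, ← u.sum_sq_norm_inner_right x]
    calc ∑ c, ‖V.conjTranspose.mulVec x.ofLp c‖ ^ 2 ≤ ∑ c, ‖inner ℂ (u (g c)) x‖ ^ 2 := by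
          refine Finset.sum_le_sum fun c _ => ?_
          rw [hV]
          split_ifs
          · exact le_rfl
          · simp
      _ = ∑ i ∈ Finset.univ.map ⟨g, hg⟩, ‖inner ℂ (u i) x‖ ^ 2 := by simp
      _ ≤ _ := Finset.sum_le_univ_sum_of_nonneg fun i => sq_nonneg _
  · rw [rangeWeight, EuclideanSpace.norm_sq_eq]
    simp only [hV, orthonormal_iff_ite.1 u.orthonormal]
    split_ifs with hi
    · obtain ⟨c, rfl⟩ := hE i hi
      rw [Finset.sum_eq_single c]
      · simp [hi]
      · intro b _ hb
        simp [hg.ne hb]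
      · simp
    · refine Finset.sum_eq_zero fun c _ => ?_
      split_ifs with h1 h2
      · exact absurd (h2 ▸ h1) hi
      · simp
      · simp

/-! ### Two-outcome POVMs and full-rank nets -/

/-- The two-outcome POVM `(V Vᴴ, 1 - V Vᴴ)` of a contraction `V`. -/
noncomputable def POVM.ofContraction {d k : ℕ} (V : Matrix (Fin d) (Fin k) ℂ) (hV : ‖V‖ ≤ 1) :
    POVM d where
  n := 2
  op := ![V * V.conjTranspose, 1 - V * V.conjTranspose]
  posSemidef i := by
    fin_cases i
    · exact Matrix.posSemidef_self_mul_conjTranspose V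
    · refine Matrix.PosSemidef.of_dotProduct_mulVec_nonneg ?_ fun x => ?_
      · exact Matrix.isHermitian_one.sub (Matrix.isHermitian_mul_conjTranspose_self V)
      · change 0 ≤ star x ⬝ᵥ (1 - V * V.conjTranspose).mulVec x
        rw [Matrix.sub_mulVec, dotProduct_sub, star_dotProduct_mul_conjTranspose,
          Matrix.one_mulVec]
        have h1 : star x ⬝ᵥ x = ((‖WithLp.toLp 2 x‖ ^ 2 : ℝ) : ℂ) := by
          simp [EuclideanSpace.norm_sq_eq, dotProduct, Complex.conj_mul']
        rw [h1, ← Complex.ofReal_sub]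
        rw [Complex.zero_le_real, sub_nonneg]
        refine pow_le_pow_left₀ (norm_nonneg _) ?_ 2
        refine (norm_conjTranspose_mulVec_le V _).trans ?_
        exact mul_le_of_le_one_left (norm_nonneg _) hV
  sum_op := by simp

theorem trace_mul_conjTranspose_mul {d k : ℕ} {Δ : Matrix (Fin d) (Fin d) ℂ} (h : Δ.IsHermitian)
    (V : Matrix (Fin d) (Fin k) ℂ) :
    (V * V.conjTranspose * Δ).trace
      = ((∑ j, h.eigenvalues j * rangeWeight V (h.eigenvectorBasis j) : ℝ) : ℂ) := by
  have e : ∀ j, (V * V.conjTranspose * eigProj h j).trace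
      = (rangeWeight V (h.eigenvectorBasis j) : ℂ) := by
    intro j
    rw [eigProj, Matrix.mul_vecMulVec, Matrix.trace_vecMulVec, dotProduct_comm,
      star_dotProduct_mul_conjTranspose]
  calc (V * V.conjTranspose * Δ).trace = (V * V.conjTranspose * (Δ * ∑ j, eigProj h j)).trace := by
        rw [sum_eigProj, mul_one]
    _ = _ := by simp [Finset.mul_sum, mul_eigProj, Matrix.trace_sum, e]

theorem trace_eq_ofReal_sum_eigenvalues {d : ℕ} {Δ : Matrix (Fin d) (Fin d) ℂ} (h : Δ.IsHermitian) :
    Δ.trace = ((∑ j, h.eigenvalues j : ℝ) : ℂ) := by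
  rw [h.trace_eq_sum_eigenvalues]; simp

theorem measNorm_ofContraction {d k : ℕ} {Δ : Matrix (Fin d) (Fin d) ℂ} (h : Δ.IsHermitian)
    (V : Matrix (Fin d) (Fin k) ℂ) (hV : ‖V‖ ≤ 1) :
    (POVM.ofContraction V hV).measNorm Δ
      = |∑ j, h.eigenvalues j * rangeWeight V (h.eigenvectorBasis j)|
        + |∑ j, h.eigenvalues j * (1 - rangeWeight V (h.eigenvectorBasis j))| := by
  have e : (POVM.ofContraction V hV).measNorm Δ
      = ‖(V * V.conjTranspose * Δ).trace‖ + ‖((1 - V * V.conjTranspose) * Δ).trace‖ := by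
    change ∑ i : Fin 2, _ = _
    rw [Fin.sum_univ_two]
    rfl
  rw [e, sub_mul, one_mul, Matrix.trace_sub, trace_mul_conjTranspose_mul h,
    trace_eq_ofReal_sum_eigenvalues h, ← Complex.ofReal_sub, Complex.norm_real, Complex.norm_real,
    ← Finset.sum_sub_distrib]
  simp [mul_sub]

/-- Taken with opposite signs, the two outcomes contribute `l * (2 * p - 1)`, which is `|l|` when
`p` is the exact indicator. -/
theorem sign_weight_estimate {l p ε : ℝ} (hp : |p - if 0 ≤ l then 1 else 0| ≤ 2 * (ε / 4)) :
    (1 - ε) * |l| ≤ l * p + -(l * (1 - p)) := by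
  rw [abs_le] at hp
  by_cases hl : 0 ≤ l
  · rw [if_pos hl] at hp
    rw [abs_of_nonneg hl]
    nlinarith [mul_nonneg hl (sub_nonneg.2 hp.1)]
  · rw [if_neg hl] at hp
    rw [not_le] at hl
    rw [abs_of_neg hl]
    nlinarith [mul_nonneg (neg_nonneg.2 hl.le) (sub_nonneg.2 hp.2)]

theorem exists_finset_ofContraction {d k : ℕ} (N : Finset (Matrix (Fin d) (Fin k) ℂ))
    (hN : ∀ V ∈ N, ‖V‖ ≤ 1) :
    ∃ F : Finset (POVM d), F.card ≤ N.card ∧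
      ∀ (V) (hV : V ∈ N), POVM.ofContraction V (hN V hV) ∈ F := by
  classical
  let f : {V // V ∈ N} → POVM d := fun V => POVM.ofContraction (d := d) (k := k) V.1 (hN V.1 V.2)
  refine ⟨N.attach.image f,
    Finset.card_image_le.trans_eq N.card_attach, fun V hV => ?_⟩
  exact Finset.mem_image.2 ⟨⟨V, hV⟩, Finset.mem_attach _ _, rfl⟩

/-- A net of contractions of full rank gives a POVM measuring `Δ` almost optimally. -/
theorem exists_net_measNorm_ge (d : ℕ) {ε : ℝ} (hε : 0 < ε) :
    ∃ F : Finset (POVM d), (F.card : ℝ) ≤ (1 + 8 / ε) ^ (2 * (d * d)) ∧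
      ∀ (Δ : Matrix (Fin d) (Fin d) ℂ) (h : Δ.IsHermitian), ∃ M ∈ F,
        (1 - ε) * hermTraceNorm h ≤ M.measNorm Δ := by
  -- A net at scale `ε / 4` moves the weights by at most `ε / 2`, and the two outcomes double this
  -- to `ε`.
  obtain ⟨N, h1, h2, h3⟩ := exists_net_matrix d d (show 0 < ε / 4 by positivity)
  obtain ⟨F, hF, hFm⟩ := exists_finset_ofContraction N h1
  refine ⟨F, ?_, fun Δ h => ?_⟩
  · refine (Nat.cast_le.2 hF).trans (h3.trans_eq ?_)
    congr 2
    field_simp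
    norm_num
  · obtain ⟨W, hW, hWi⟩ := exists_rangeWeight_eq_indicator h.eigenvectorBasis
      Function.injective_id (E := Finset.univ.filter fun i => 0 ≤ h.eigenvalues i)
      fun i _ => ⟨i, rfl⟩
    obtain ⟨V, hV, hVW⟩ := h2 W hW
    refine ⟨_, hFm V hV, ?_⟩
    rw [measNorm_ofContraction h]
    refine le_trans ?_ (add_le_add (le_abs_self _) (neg_le_abs _))
    rw [← Finset.sum_neg_distrib, ← Finset.sum_add_distrib, hermTraceNorm, Finset.mul_sum]
    refine Finset.sum_le_sum fun i _ => ?_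
    have hp := abs_le.1 ((abs_rangeWeight_sub_le (h1 V hV) hW
      (h.eigenvectorBasis.orthonormal.1 i)).trans (mul_le_mul_of_nonneg_left hVW zero_le_two))
    rw [hWi] at hp
    refine sign_weight_estimate ?_
    simpa using abs_le.2 hp

/-! ### Low-rank nets -/

/-- The indices of the `k` largest values of a function. -/
theorem exists_card_eq_forall_le {d : ℕ} (x : Fin d → ℝ) {k : ℕ} (hk : k ≤ d) :
    ∃ E : Finset (Fin d), E.card = k ∧ ∀ i ∈ E, ∀ j ∉ E, x j ≤ x i := by
  induction k with
  | zero => exact ⟨∅, by simp⟩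
  | succ k ih =>
    obtain ⟨E, hE, h⟩ := ih (by omega)
    have hne : Eᶜ.Nonempty := by
      rw [← Finset.card_pos, Finset.card_compl, hE, Fintype.card_fin]
      omega
    obtain ⟨m, hm, hmax⟩ := Eᶜ.exists_max_image x hne
    rw [Finset.mem_compl] at hm
    refine ⟨insert m E, by rw [Finset.card_insert_of_notMem hm, hE], fun i hi j hj => ?_⟩
    rw [Finset.mem_insert, not_or] at hj
    rcases Finset.mem_insert.1 hi with rfl | hi
    · exact hmax j (Finset.mem_compl.2 hj.2)
    · exact h i hi j hj.2

theorem mul_le_sum_of_forall_le {d : ℕ} {x : Fin d → ℝ} {E : Finset (Fin d)}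
    (h : ∀ i ∈ E, ∀ j ∉ E, x j ≤ x i) {j : Fin d} (hj : j ∉ E) :
    E.card * x j ≤ ∑ i ∈ E, x i := by
  rw [← nsmul_eq_mul]
  exact Finset.card_nsmul_le_sum _ _ _ fun i hi => h i hi j hj

/-- The average over the largest entries is at least the average over all of them. -/
theorem card_mul_sum_le_of_forall_le {d : ℕ} {x : Fin d → ℝ} {E : Finset (Fin d)}
    (h : ∀ i ∈ E, ∀ j ∉ E, x j ≤ x i) :
    E.card * ∑ i, x i ≤ d * ∑ i ∈ E, x i := by
  have h1 : E.card * ∑ i ∈ Eᶜ, x i ≤ (d - E.card) * ∑ i ∈ E, x i := by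
    rw [Finset.mul_sum]
    refine (Finset.sum_le_card_nsmul _ _ _ fun j hj =>
      mul_le_sum_of_forall_le h (Finset.mem_compl.1 hj)).trans_eq ?_
    have : E.card ≤ d := by simpa using E.card_le_univ
    rw [nsmul_eq_mul, Finset.card_compl, Fintype.card_fin, Nat.cast_sub this]
  rw [← Finset.sum_add_sum_compl E x]
  linarith

/-- A single outcome can exploit eigenvalues of one sign only. Keeping the heavier sign costs at
most half. -/
theorem exists_subset_sign {d : ℕ} (l : Fin d → ℝ) (E : Finset (Fin d)) :
    ∃ τ : ℝ, |τ| = 1 ∧ ∃ E' ⊆ E, (∀ i ∈ E', τ * l i = |l i|) ∧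
      (∑ i ∈ E, |l i|) / 2 ≤ ∑ i ∈ E', |l i| := by
  have hs := Finset.sum_filter_add_sum_filter_not E (fun i => 0 ≤ l i) fun i => |l i|
  rcases le_total (∑ i ∈ E with ¬ 0 ≤ l i, |l i|) (∑ i ∈ E with 0 ≤ l i, |l i|) with h | h
  · refine ⟨1, by simp, E.filter (fun i => 0 ≤ l i), Finset.filter_subset _ _, fun i hi => ?_, by linarith⟩
    rw [abs_of_nonneg (Finset.mem_filter.1 hi).2, one_mul]
  · refine ⟨-1, by simp, E.filter (fun i => ¬ 0 ≤ l i), Finset.filter_subset _ _, fun i hi => ?_, by linarith⟩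
    rw [abs_of_neg (not_le.1 (Finset.mem_filter.1 hi).2), neg_one_mul]

/-- A net of contractions of rank `k` captures the fraction `k / (4 * d)` of the trace norm. -/
theorem exists_lowRank_net_measNorm_ge {d k : ℕ} (hd : 1 ≤ d) (hk : k ≤ d) :
    ∃ F : Finset (POVM d), (F.card : ℝ) ≤ 21 ^ (2 * (d * k)) ∧
      ∀ (Δ : Matrix (Fin d) (Fin d) ℂ) (h : Δ.IsHermitian), ∃ M ∈ F,
        k / (4 * d) * hermTraceNorm h ≤ M.measNorm Δ := by
  -- Scale `1 / 10` gives relative errors `1 / 5` on `E` and `1 / 100` off `E`, and `1/2 - 1/5 -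
  -- 1/100 ≥ 1/4`. The base of the cardinality is `1 + 2 * 10 = 21`.
  obtain ⟨N, h1, h2, h3⟩ := exists_net_matrix d k (show (0 : ℝ) < 1 / 10 by norm_num)
  obtain ⟨F, hF, hFm⟩ := exists_finset_ofContraction N h1
  refine ⟨F, (Nat.cast_le.2 hF).trans (h3.trans_eq (by norm_num)), fun Δ h => ?_⟩
  set l := h.eigenvalues with hl
  set u := h.eigenvectorBasis with hu
  obtain ⟨E, hEk, hE⟩ := exists_card_eq_forall_le (fun i => |l i|) hk
  obtain ⟨τ, hτ, E', hE'E, hE', hsum⟩ := exists_subset_sign l E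
  set s := ∑ i ∈ E, |l i| with hs
  have hs0 : 0 ≤ s := Finset.sum_nonneg fun i _ => abs_nonneg _
  let e := E.equivFinOfCardEq hEk
  obtain ⟨W, hW, hWi⟩ := exists_rangeWeight_eq_indicator u (E := E')
    (g := fun c => (e.symm c : Fin d)) (Subtype.val_injective.comp e.symm.injective)
    fun i hi => ⟨e ⟨i, hE'E hi⟩, by simp⟩
  obtain ⟨V, hV, hVW⟩ := h2 W hW
  refine ⟨_, hFm V hV, ?_⟩
  rw [measNorm_ofContraction h]
  have hpert (i) := abs_le.1 ((abs_rangeWeight_sub_le (h1 V hV) hW (u.orthonormal.1 i)).trans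
    (mul_le_mul_of_nonneg_left hVW zero_le_two))
  have hin : s / 2 - s * (1 / 5) ≤ ∑ i ∈ E, τ * (l i * rangeWeight V (u i)) := by
    calc s / 2 - s * (1 / 5) ≤ ∑ i ∈ E, ((if i ∈ E' then |l i| else 0) - |l i| * (1 / 5)) := by
          rw [Finset.sum_sub_distrib, ← Finset.sum_mul, Finset.sum_ite_mem,
            Finset.inter_eq_right.2 hE'E]
          linarith
      _ ≤ _ := by
          refine Finset.sum_le_sum fun i _ => ?_
          have hp := hpert i
          rw [hWi] at hp
          have ha := abs_nonneg (l i)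
          split_ifs at hp ⊢ with hi
          · rw [← mul_assoc, hE' i hi]
            nlinarith [hp.1]
          · have h5 : |τ * (l i * rangeWeight V (u i))| ≤ |l i| * (1 / 5) := by
              rw [abs_mul, hτ, one_mul, abs_mul, abs_of_nonneg (rangeWeight_nonneg _ _)]
              nlinarith [hp.2]
            linarith [(abs_le.1 h5).1]
  -- Off `E` every `|l i|` is at most the average `s / k`, while the total weight there is at most
  -- `k / 100`; the factors `k` cancel.
  have hout : -(s * (1 / 100)) ≤ ∑ i ∈ Eᶜ, τ * (l i * rangeWeight V (u i)) := by
    have hw : ∑ i ∈ Eᶜ, rangeWeight V (u i) ≤ k * (1 / 100) := by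
      calc ∑ i ∈ Eᶜ, rangeWeight V (u i) = ∑ i ∈ Eᶜ, rangeWeight (V - W) (u i) := by
            refine Finset.sum_congr rfl fun i hi => rangeWeight_eq_of_rangeWeight_eq_zero ?_
            rw [hWi, if_neg fun h' => Finset.mem_compl.1 hi (hE'E h')]
        _ ≤ ∑ i, rangeWeight (V - W) (u i) :=
            Finset.sum_le_univ_sum_of_nonneg fun i => rangeWeight_nonneg _ _
        _ ≤ k * ‖V - W‖ ^ 2 := sum_rangeWeight_le _ _
        _ ≤ k * (1 / 10) ^ 2 := by gcongr
        _ = _ := by norm_num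
    rcases Nat.eq_zero_or_pos k with rfl | hkpos
    · have hz : ∑ i ∈ Eᶜ, rangeWeight V (u i) = 0 :=
        le_antisymm (by simpa using hw) (Finset.sum_nonneg fun i _ => rangeWeight_nonneg _ _)
      rw [Finset.sum_eq_zero_iff_of_nonneg fun i _ => rangeWeight_nonneg _ _] at hz
      rw [Finset.sum_eq_zero fun i hi => by rw [hz i hi]; ring]
      linarith
    have hkR : (0 : ℝ) < k := by exact_mod_cast hkpos
    have hb : ∀ i ∈ Eᶜ, -(s / k * rangeWeight V (u i)) ≤ τ * (l i * rangeWeight V (u i)) := by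
      intro i hi
      have h6 := mul_le_sum_of_forall_le hE (Finset.mem_compl.1 hi)
      rw [hEk, mul_comm, ← le_div_iff₀ hkR] at h6
      have h7 : |τ * (l i * rangeWeight V (u i))| ≤ s / k * rangeWeight V (u i) := by
        rw [abs_mul, hτ, one_mul, abs_mul, abs_of_nonneg (rangeWeight_nonneg _ _)]
        exact mul_le_mul_of_nonneg_right h6 (rangeWeight_nonneg _ _)
      exact (abs_le.1 h7).1
    refine le_trans ?_ (Finset.sum_le_sum hb)
    rw [Finset.sum_neg_distrib, ← Finset.mul_sum, neg_le_neg_iff]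
    calc s / k * ∑ i ∈ Eᶜ, rangeWeight V (u i) ≤ s / k * (k * (1 / 100)) := by gcongr
      _ = s * (1 / 100) := by field_simp
  have htot : s / 4 ≤ ∑ i, τ * (l i * rangeWeight V (u i)) := by
    rw [← Finset.sum_add_sum_compl E]
    linarith
  rw [← Finset.mul_sum] at htot
  have hfin : s / 4 ≤ |∑ i, l i * rangeWeight V (u i)| := by
    refine htot.trans ((le_abs_self _).trans_eq ?_)
    rw [abs_mul, hτ, one_mul]
  have hcard := card_mul_sum_le_of_forall_le hE
  rw [hEk] at hcard
  have hdR : (0 : ℝ) < d := by exact_mod_cast hd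
  have : k / (4 * d) * hermTraceNorm h ≤ s / 4 := by
    rw [hermTraceNorm, div_mul_eq_mul_div, div_le_iff₀ (by positivity)]
    linarith
  linarith [abs_nonneg (∑ j, l j * (1 - rangeWeight V (u j)))]

/-! ### An informationally complete POVM -/

/-- A POVM indexed by an arbitrary finite type. -/
noncomputable def POVM.ofFintype {d : ℕ} {ι : Type*} [Fintype ι]
    (op : ι → Matrix (Fin d) (Fin d) ℂ) (hop : ∀ i, (op i).PosSemidef) (hsum : ∑ i, op i = 1) :
    POVM d where
  n := Fintype.card ι
  op i := op ((Fintype.equivFin ι).symm i)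
  posSemidef i := hop _
  sum_op := by rw [← hsum]; exact Equiv.sum_comp _ op

theorem measNorm_ofFintype {d : ℕ} {ι : Type*} [Fintype ι]
    (op : ι → Matrix (Fin d) (Fin d) ℂ) (hop : ∀ i, (op i).PosSemidef) (hsum : ∑ i, op i = 1)
    (Δ : Matrix (Fin d) (Fin d) ℂ) :
    (POVM.ofFintype op hop hsum).measNorm Δ = ∑ i, ‖(op i * Δ).trace‖ :=
  Equiv.sum_comp (Fintype.equivFin ι).symm fun i => ‖(op i * Δ).trace‖

/-- The vector `e_i + I ^ k e_j`. -/
noncomputable def pairVec {d : ℕ} (i j : Fin d) (k : Fin 4) : Fin d → ℂ :=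
  Pi.single i 1 + Complex.I ^ (k : ℕ) • Pi.single j 1

/-- Averaging over the fourth roots of unity kills the cross terms. -/
theorem sum_vecMulVec_pairVec {d : ℕ} (i j : Fin d) :
    ∑ k, Matrix.vecMulVec (pairVec i j k) (star (pairVec i j k))
      = (4 : ℂ) • (Matrix.single i i 1 + Matrix.single j j 1) := by
  ext a b
  have hstar : ∀ i : Fin d, (starRingEnd ℂ) ((Pi.single i 1 : Fin d → ℂ) b)
      = (Pi.single i 1 : Fin d → ℂ) b := by
    intro i
    by_cases h : b = i <;> simp [h]
  have hsingle : ∀ i : Fin d, Matrix.single i i (1 : ℂ) a b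
      = (Pi.single i 1 : Fin d → ℂ) a * (Pi.single i 1 : Fin d → ℂ) b := by
    intro i
    by_cases h : a = i <;> by_cases h' : b = i <;> simp [h, h', eq_comm]
  have hI : Complex.I ^ 2 = -1 := Complex.I_sq
  simp only [Fin.sum_univ_four, pairVec, Matrix.add_apply, Matrix.vecMulVec_apply, Pi.add_apply,
    Pi.smul_apply, Pi.star_apply, Matrix.smul_apply, smul_eq_mul, hsingle, Complex.star_def,
    map_add, map_mul, map_pow, hstar, Complex.conj_I, Fin.val_zero, Fin.val_one, Fin.val_two,
    show ((3 : Fin 4) : ℕ) = 3 from rfl]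
  generalize (Pi.single i 1 : Fin d → ℂ) a = p
  generalize (Pi.single i 1 : Fin d → ℂ) b = r
  generalize (Pi.single j 1 : Fin d → ℂ) a = q
  generalize (Pi.single j 1 : Fin d → ℂ) b = t
  rw [pow_succ Complex.I 2, pow_succ (-Complex.I) 2, neg_sq, hI]
  linear_combination (-2 * q * t) * hI

theorem sum_single_diag {d : ℕ} :
    ∑ i : Fin d, ∑ j : Fin d, (Matrix.single i i (1 : ℂ) + Matrix.single j j 1)
      = (2 * d : ℂ) • (1 : Matrix (Fin d) (Fin d) ℂ) := by
  simp only [Finset.sum_add_distrib, Finset.sum_const, Finset.card_univ, Fintype.card_fin,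
    ← Finset.smul_sum, Matrix.sum_single_one]
  ext a b
  by_cases h : a = b <;> simp [Matrix.natCast_apply, h]
  ring

/-- Polarisation: opposite roots of unity share the diagonal part, so the triangle inequality
removes it and leaves `z + w` and `z - w` up to a phase; these two recover `z`. -/
theorem four_mul_norm_le_sum_trace {d : ℕ} (Δ : Matrix (Fin d) (Fin d) ℂ) (i j : Fin d) :
    4 * ‖Δ i j‖ ≤
      ∑ k, ‖(Matrix.vecMulVec (pairVec i j k) (star (pairVec i j k)) * Δ).trace‖ := by
  set T : Fin 4 → ℂ := fun k =>
    (Matrix.vecMulVec (pairVec i j k) (star (pairVec i j k)) * Δ).trace with hT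
  have e : ∀ k : Fin 4, T k
      = Δ i i + (star Complex.I ^ (k : ℕ) * Complex.I ^ (k : ℕ)) * Δ j j
        + (Complex.I ^ (k : ℕ) * Δ i j + star Complex.I ^ (k : ℕ) * Δ j i) := by
    intro k
    rw [hT]
    dsimp only
    rw [Matrix.trace_mul_comm, Matrix.mul_vecMulVec, Matrix.trace_vecMulVec, dotProduct_comm]
    simp only [pairVec, Matrix.mulVec_add, Matrix.mulVec_smul, star_add, star_smul,
      add_dotProduct, dotProduct_add, smul_dotProduct, dotProduct_smul, smul_eq_mul,
      Matrix.mulVec_single_one, Pi.star_single, star_one, single_one_dotProduct, star_pow,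
      Matrix.col_apply]
    ring
  have hI : Complex.I ^ 2 = -1 := Complex.I_sq
  set x := Δ i i + Δ j j
  set z := Δ i j
  set w := Δ j i
  have h1 : 2 * ‖z + w‖ ≤ ‖x + (z + w)‖ + ‖x - (z + w)‖ := by
    have := norm_sub_le (x + (z + w)) (x - (z + w))
    rwa [show x + (z + w) - (x - (z + w)) = 2 * (z + w) by ring, norm_mul, Complex.norm_two] at this
  have h2 : 2 * ‖z - w‖ ≤ ‖x + Complex.I * (z - w)‖ + ‖x - Complex.I * (z - w)‖ := by
    have := norm_sub_le (x + Complex.I * (z - w)) (x - Complex.I * (z - w))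
    rwa [show x + Complex.I * (z - w) - (x - Complex.I * (z - w))
      = 2 * (Complex.I * (z - w)) by ring, norm_mul, norm_mul, Complex.norm_two, Complex.norm_I,
      one_mul] at this
  have h3 : 2 * ‖z‖ ≤ ‖z + w‖ + ‖z - w‖ := by
    have := norm_add_le (z + w) (z - w)
    rwa [show z + w + (z - w) = 2 * z by ring, norm_mul, Complex.norm_two] at this
  have e0 : T 0 = x + (z + w) := by
    rw [e, Fin.val_zero]; simp only [x]; ring
  have e1 : T 1 = x + Complex.I * (z - w) := by
    rw [e, Fin.val_one, Complex.star_def, Complex.conj_I]; simp only [x]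
    linear_combination (-Δ j j) * hI
  have e2 : T 2 = x - (z + w) := by
    rw [e, Fin.val_two, Complex.star_def, Complex.conj_I, neg_sq, hI]; simp only [x]; ring
  have e3 : T 3 = x - Complex.I * (z - w) := by
    rw [e, show ((3 : Fin 4) : ℕ) = 3 from rfl, Complex.star_def, Complex.conj_I,
      pow_succ Complex.I 2, pow_succ (-Complex.I) 2, neg_sq, hI]
    simp only [x]
    linear_combination (-Δ j j) * hI
  change 4 * ‖z‖ ≤ ∑ k, ‖T k‖
  rw [Fin.sum_univ_four, e0, e1, e2, e3]
  linarith

/-- Each eigenvalue is expanded as `⟨u j, Δ (u j)⟩`. After summing over `j`, the coefficient of each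
entry is at most 1 because the eigenvector matrix has unit rows. -/
theorem hermTraceNorm_le_sum_norm {d : ℕ} {Δ : Matrix (Fin d) (Fin d) ℂ} (h : Δ.IsHermitian) :
    hermTraceNorm h ≤ ∑ a, ∑ b, ‖Δ a b‖ := by
  set u := h.eigenvectorBasis with hu
  have hrow : ∀ a, ∑ j, ‖u j a‖ ^ 2 = 1 := by
    intro a
    have := u.sum_sq_norm_inner_right (EuclideanSpace.single a (1 : ℂ))
    simpa [EuclideanSpace.inner_single_right] using this
  have hpair : ∀ a b, ∑ j, ‖u j a‖ * ‖u j b‖ ≤ 1 := by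
    intro a b
    calc ∑ j, ‖u j a‖ * ‖u j b‖ ≤ ∑ j, (‖u j a‖ ^ 2 + ‖u j b‖ ^ 2) / 2 :=
          Finset.sum_le_sum fun j _ => by nlinarith [sq_nonneg (‖u j a‖ - ‖u j b‖)]
      _ = 1 := by rw [← Finset.sum_div, Finset.sum_add_distrib, hrow, hrow]; norm_num
  have hl : ∀ j, |h.eigenvalues j| ≤ ∑ a, ∑ b, ‖Δ a b‖ * (‖u j a‖ * ‖u j b‖) := by
    intro j
    have e : ((h.eigenvalues j : ℝ) : ℂ) = ∑ a, ∑ b, Δ a b * u j b * star (u j a) := by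
      have h1 : (Δ * eigProj h j).trace = (h.eigenvalues j : ℂ) := by
        rw [mul_eigProj, Matrix.trace_smul, trace_eigProj, smul_eq_mul, mul_one]
      rw [← h1, eigProj, Matrix.mul_vecMulVec, Matrix.trace_vecMulVec]
      simp [dotProduct, Matrix.mulVec, Finset.sum_mul, hu]
    rw [← Real.norm_eq_abs, ← Complex.norm_real, e]
    refine (norm_sum_le _ _).trans (Finset.sum_le_sum fun a _ => (norm_sum_le _ _).trans
      (Finset.sum_le_sum fun b _ => ?_))
    rw [norm_mul, norm_mul, norm_star]
    exact le_of_eq (by ring)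
  calc hermTraceNorm h ≤ ∑ j, ∑ a, ∑ b, ‖Δ a b‖ * (‖u j a‖ * ‖u j b‖) :=
        Finset.sum_le_sum fun j _ => hl j
    _ = ∑ a, ∑ b, ‖Δ a b‖ * ∑ j, ‖u j a‖ * ‖u j b‖ := by
        simp_rw [Finset.mul_sum]
        rw [Finset.sum_comm]
        exact Finset.sum_congr rfl fun a _ => Finset.sum_comm
    _ ≤ ∑ a, ∑ b, ‖Δ a b‖ := Finset.sum_le_sum fun a _ => Finset.sum_le_sum fun b _ =>
        mul_le_of_le_one_right (norm_nonneg _) (hpair a b)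

/-- An informationally complete POVM which loses at most a factor `2 * d`. -/
theorem exists_povm_measNorm_ge {d : ℕ} (hd : 1 ≤ d) :
    ∃ M : POVM d, ∀ (Δ : Matrix (Fin d) (Fin d) ℂ) (h : Δ.IsHermitian),
      1 / (2 * d) * hermTraceNorm h ≤ M.measNorm Δ := by
  have hd0 : (d : ℂ) ≠ 0 := by exact_mod_cast (by omega : d ≠ 0)
  have hdR : (0 : ℝ) < d := by exact_mod_cast hd
  -- The normalisation `8 * d` is 4 from the roots of unity times `2 * d` from the sum over pairs.
  let op : (Fin d × Fin d) × Fin 4 → Matrix (Fin d) (Fin d) ℂ := fun p =>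
    ((1 / (8 * d) : ℝ) : ℂ) •
      Matrix.vecMulVec (pairVec p.1.1 p.1.2 p.2) (star (pairVec p.1.1 p.1.2 p.2))
  refine ⟨POVM.ofFintype op (fun p => ?_) ?_, fun Δ h => ?_⟩
  · refine (Matrix.posSemidef_vecMulVec_self_star _).smul ?_
    rw [Complex.zero_le_real]
    positivity
  · simp only [op, ← Finset.smul_sum, Fintype.sum_prod_type, sum_vecMulVec_pairVec,
      sum_single_diag, smul_smul]
    rw [show ((1 / (8 * d) : ℝ) : ℂ) * (4 * (2 * d)) = 1 by push_cast; field_simp; norm_num,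
      one_smul]
  · rw [measNorm_ofFintype]
    have e : ∀ p, ‖(op p * Δ).trace‖ = 1 / (8 * d) * ‖(Matrix.vecMulVec
        (pairVec p.1.1 p.1.2 p.2) (star (pairVec p.1.1 p.1.2 p.2)) * Δ).trace‖ := by
      intro p
      rw [Matrix.smul_mul, Matrix.trace_smul, norm_smul, Complex.norm_real, Real.norm_eq_abs,
        abs_of_nonneg (by positivity)]
    simp only [e, ← Finset.mul_sum, Fintype.sum_prod_type]
    calc 1 / (2 * d) * hermTraceNorm h ≤ 1 / (2 * d) * ∑ a, ∑ b, ‖Δ a b‖ := by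
          gcongr
          exact hermTraceNorm_le_sum_norm h
      _ = 1 / (8 * d) * ∑ a, ∑ b, 4 * ‖Δ a b‖ := by
          simp only [← Finset.mul_sum]
          field_simp
          ring
      _ ≤ _ := by
          gcongr with a _ b _
          exact four_mul_norm_le_sum_trace Δ a b

/-! ### Part (i): choosing the construction according to `ε` -/

theorem le_distNorm_of_mem {d : ℕ} {F : Finset (POVM d)} {M : POVM d} (hM : M ∈ F)
    {Δ : Matrix (Fin d) (Fin d) ℂ} (h : Δ.IsHermitian) :
    M.measNorm Δ ≤ distNorm (F : Set (POVM d)) Δ :=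
  le_csSup (POVM.bddAbove_measNorm _ h) ⟨M, hM, rfl⟩

theorem hermTraceNorm_nonneg {d : ℕ} {Δ : Matrix (Fin d) (Fin d) ℂ} (h : Δ.IsHermitian) :
    0 ≤ hermTraceNorm h := Finset.sum_nonneg fun _ _ => abs_nonneg _

theorem one_sub_le_abs_log {ε : ℝ} (h0 : 0 < ε) (h1 : ε < 1) : 1 - ε ≤ |Real.log ε| := by
  rw [abs_of_neg (Real.log_neg h0 h1)]
  linarith [Real.log_le_sub_one_of_pos h0]

theorem one_add_eight_div_le {ε : ℝ} (h0 : 0 < ε) (h1 : ε ≤ 1 / 2) :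
    1 + 8 / ε ≤ Real.exp (5 * |Real.log ε|) := by
  have e : Real.exp (5 * |Real.log ε|) = (ε ^ 5)⁻¹ := by
    rw [abs_of_neg (Real.log_neg h0 (by linarith)), show 5 * -Real.log ε = -(Real.log (ε ^ 5)) by
      rw [Real.log_pow]; push_cast; ring, Real.exp_neg, Real.exp_log (by positivity)]
  have h4 : ε ^ 4 ≤ (1 / 2) ^ 4 := pow_le_pow_left₀ h0.le h1 4
  rw [e, le_inv_comm₀ (by positivity) (by positivity), inv_eq_one_div, le_div_iff₀ (by positivity)]
  have : ε ^ 5 * (1 + 8 / ε) = ε ^ 4 * (ε + 8) := by field_simp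
  rw [this]
  nlinarith [pow_pos h0 4]

theorem pow_le_exp_of_le {x a b : ℝ} {n : ℕ} (h0 : 0 ≤ x) (hx : x ≤ Real.exp a)
    (h : n * a ≤ b) : x ^ n ≤ Real.exp b :=
  calc x ^ n ≤ Real.exp a ^ n := pow_le_pow_left₀ h0 hx n
    _ = Real.exp (n * a) := (Real.exp_nat_mul a n).symm
    _ ≤ _ := Real.exp_le_exp.2 h

theorem twentyone_le_exp_four : (21 : ℝ) ≤ Real.exp 4 := by
  have h := Real.exp_one_gt_d9
  have : Real.exp 4 = Real.exp 1 ^ 4 := by rw [← Real.exp_nat_mul]; norm_num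
  rw [this]
  calc (21 : ℝ) ≤ 2.7 ^ 4 := by norm_num
    _ ≤ _ := pow_le_pow_left₀ (by norm_num) (by linarith) 4

/-- Few POVMs suffice to approximate the trace norm. -/
theorem exists_finset_povm_approx {d : ℕ} (hd : 1 ≤ d) {ε : ℝ} (h0 : 0 < ε) (h1 : ε < 1) :
    ∃ F : Finset (POVM d), (F.card : ℝ) ≤ Real.exp (48 * |Real.log ε| * (d : ℝ) ^ 2) ∧
      ∀ (Δ : Matrix (Fin d) (Fin d) ℂ) (h : Δ.IsHermitian), ∃ M ∈ F,
        (1 - ε) * hermTraceNorm h ≤ M.measNorm Δ := by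
  have hlog := one_sub_le_abs_log h0 h1
  have hd1 : (1 : ℝ) ≤ d := by exact_mod_cast hd
  have hlog0 := abs_nonneg (Real.log ε)
  rcases le_or_gt ε (1 / 2) with h2 | h2
  · obtain ⟨F, hF, hM⟩ := exists_net_measNorm_ge d h0
    refine ⟨F, hF.trans (pow_le_exp_of_le (by positivity) (one_add_eight_div_le h0 h2) ?_), hM⟩
    push_cast
    nlinarith [mul_nonneg hlog0 (sq_nonneg (d : ℝ))]
  rcases le_or_gt ε (3 / 4) with h3 | h3
  -- Here `|log ε| ≥ 1 / 4`, so the finer net for `1 / 2` is affordable.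
  · obtain ⟨F, hF, hM⟩ := exists_net_measNorm_ge d (ε := 1 / 2) (by norm_num)
    refine ⟨F, hF.trans (pow_le_exp_of_le (a := 4) (by norm_num)
      (le_trans (by norm_num) twentyone_le_exp_four) ?_), fun Δ h => ?_⟩
    · push_cast
      nlinarith [mul_le_mul_of_nonneg_right (show 1 / 4 ≤ |Real.log ε| by linarith)
        (sq_nonneg (d : ℝ))]
    · obtain ⟨M, hMF, hM⟩ := hM Δ h
      refine ⟨M, hMF, le_trans ?_ hM⟩
      exact mul_le_mul_of_nonneg_right (by linarith) (hermTraceNorm_nonneg h)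
  rcases le_or_gt (1 / 2) ((1 - ε) * d) with h4 | h4
  -- This rank makes `k / (4 * d) ≥ 1 - ε`, and `ε > 3 / 4` keeps it at most `d`.
  · set k := ⌈4 * ((1 - ε) * d)⌉₊ with hk
    have hk1 : 4 * ((1 - ε) * d) ≤ k := Nat.le_ceil _
    have hk2 : (k : ℝ) < 4 * ((1 - ε) * d) + 1 := Nat.ceil_lt_add_one (by positivity)
    have hkd : k ≤ d := by
      rw [hk, Nat.ceil_le]
      nlinarith
    obtain ⟨F, hF, hM⟩ := exists_lowRank_net_measNorm_ge hd hkd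
    refine ⟨F, hF.trans (pow_le_exp_of_le (by norm_num) twentyone_le_exp_four ?_), fun Δ h => ?_⟩
    · push_cast
      -- The rounding is absorbed because `(1 - ε) * d ≥ 1 / 2`. The constant 48 is `4 * 2 * 6`.
      have h6 : (k : ℝ) ≤ 6 * ((1 - ε) * d) := by linarith
      have h7 : (d : ℝ) * k ≤ d * (6 * (|Real.log ε| * d)) := by
        gcongr
        refine h6.trans ?_
        gcongr
      nlinarith
    · obtain ⟨M, hMF, hM⟩ := hM Δ h
      refine ⟨M, hMF, le_trans ?_ hM⟩
      refine mul_le_mul_of_nonneg_right ?_ (hermTraceNorm_nonneg h)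
      rw [le_div_iff₀ (by positivity)]
      linarith
  · obtain ⟨M, hM⟩ := exists_povm_measNorm_ge hd
    refine ⟨{M}, ?_, fun Δ h => ⟨M, Finset.mem_singleton_self M, le_trans ?_ (hM Δ h)⟩⟩
    · rw [Finset.card_singleton, Nat.cast_one]
      exact Real.one_le_exp (by positivity)
    · refine mul_le_mul_of_nonneg_right ?_ (hermTraceNorm_nonneg h)
      rw [le_div_iff₀ (by positivity)]
      linarith

/-! ### Gaussian integrals -/

theorem gaussian_quadratic_eq_prod {ι : Type*} [Fintype ι]
    (b : OrthonormalBasis ι ℝ (EuclideanSpace ℝ ι)) (κ : ι → ℝ) (y : EuclideanSpace ℝ ι) :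
    Real.exp (-(‖b.repr.symm y‖ ^ 2 / 2) + 1 / 4 * ∑ j, κ j * inner ℝ (b j) (b.repr.symm y) ^ 2)
      = ∏ j, Real.exp (-(1 / 2 - κ j / 4) * y j ^ 2) := by
  have e : ∀ j, inner ℝ (b j) (b.repr.symm y) = y j := by
    intro j
    rw [← b.repr_apply_apply, LinearIsometryEquiv.apply_symm_apply]
  simp only [e, LinearIsometryEquiv.norm_map]
  rw [EuclideanSpace.real_norm_sq_eq, ← Real.exp_sum, Finset.sum_div, Finset.mul_sum,
    ← Finset.sum_neg_distrib, ← Finset.sum_add_distrib]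
  congr 1
  exact Finset.sum_congr rfl fun j _ => by ring

theorem integrable_gaussian_quadratic {ι : Type*} [Fintype ι]
    (b : OrthonormalBasis ι ℝ (EuclideanSpace ℝ ι)) {κ : ι → ℝ} (hκ : ∀ j, κ j < 2) :
    MeasureTheory.Integrable fun x : EuclideanSpace ℝ ι =>
      Real.exp (-(‖x‖ ^ 2 / 2) + 1 / 4 * ∑ j, κ j * inner ℝ (b j) x ^ 2) := by
  rw [← (b.repr.symm.measurePreserving).integrable_comp_emb
      b.repr.symm.toHomeomorph.measurableEmbedding,
    ← (PiLp.volume_preserving_toLp ι).integrable_comp_emb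
      (MeasurableEquiv.toLp 2 _).measurableEmbedding]
  simp only [Function.comp_def, gaussian_quadratic_eq_prod]
  exact MeasureTheory.Integrable.fintype_prod (f := fun j (t : ℝ) =>
    Real.exp (-(1 / 2 - κ j / 4) * t ^ 2)) fun j =>
    integrable_exp_neg_mul_sq (by linarith [hκ j])

theorem integral_gaussian_quadratic {ι : Type*} [Fintype ι]
    (b : OrthonormalBasis ι ℝ (EuclideanSpace ℝ ι)) (κ : ι → ℝ) :
    ∫ x : EuclideanSpace ℝ ι,
      Real.exp (-(‖x‖ ^ 2 / 2) + 1 / 4 * ∑ j, κ j * inner ℝ (b j) x ^ 2)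
      = ∏ j, √(Real.pi / (1 / 2 - κ j / 4)) := by
  rw [← (b.repr.symm.measurePreserving).integral_comp
      b.repr.symm.toHomeomorph.measurableEmbedding,
    ← (PiLp.volume_preserving_toLp ι).integral_comp
      (MeasurableEquiv.toLp 2 _).measurableEmbedding]
  simp only [gaussian_quadratic_eq_prod]
  rw [MeasureTheory.integral_fintype_prod_volume_eq_prod (f := fun j (t : ℝ) =>
    Real.exp (-(1 / 2 - κ j / 4) * t ^ 2))]
  simp only [integral_gaussian]

theorem integrable_exp_neg_norm_sq_half (ι : Type*) [Fintype ι] :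
    MeasureTheory.Integrable fun x : EuclideanSpace ℝ ι => Real.exp (-(‖x‖ ^ 2 / 2)) := by
  classical
  simpa using integrable_gaussian_quadratic (EuclideanSpace.basisFun ι ℝ) (κ := fun _ => 0)
    fun _ => by norm_num

theorem integral_exp_neg_norm_sq_half (ι : Type*) [Fintype ι] :
    ∫ x : EuclideanSpace ℝ ι, Real.exp (-(‖x‖ ^ 2 / 2))
      = √(2 * Real.pi) ^ Fintype.card ι := by
  classical
  have := integral_gaussian_quadratic (EuclideanSpace.basisFun ι ℝ) (κ := fun _ => 0)
  simp only [zero_mul, Finset.sum_const_zero, mul_zero, add_zero, zero_div, sub_zero,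
    Finset.prod_const, Finset.card_univ] at this
  rw [this]
  congr 2
  field_simp

theorem exp_neg_norm_sq_add_inner {ι : Type*} [Fintype ι] (w x : EuclideanSpace ℝ ι) :
    Real.exp (-(‖x‖ ^ 2 / 2) + inner ℝ w x)
      = Real.exp (‖w‖ ^ 2 / 2) * Real.exp (-(‖x - w‖ ^ 2 / 2)) := by
  rw [← Real.exp_add, norm_sub_sq_real, real_inner_comm]
  congr 1
  ring

theorem integrable_exp_neg_norm_sq_add_inner {ι : Type*} [Fintype ι] (w : EuclideanSpace ℝ ι) :
    MeasureTheory.Integrable fun x : EuclideanSpace ℝ ι =>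
      Real.exp (-(‖x‖ ^ 2 / 2) + inner ℝ w x) := by
  simp only [exp_neg_norm_sq_add_inner]
  exact ((integrable_exp_neg_norm_sq_half ι).comp_sub_right w).const_mul _

theorem integral_exp_neg_norm_sq_add_inner {ι : Type*} [Fintype ι] (w : EuclideanSpace ℝ ι) :
    ∫ x : EuclideanSpace ℝ ι, Real.exp (-(‖x‖ ^ 2 / 2) + inner ℝ w x)
      = √(2 * Real.pi) ^ Fintype.card ι * Real.exp (‖w‖ ^ 2 / 2) := by
  simp only [exp_neg_norm_sq_add_inner]
  rw [MeasureTheory.integral_const_mul,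
    MeasureTheory.integral_sub_right_eq_self (fun x => Real.exp (-(‖x‖ ^ 2 / 2))) w,
    integral_exp_neg_norm_sq_half, mul_comm]

/-- This is `(1 - t / 2)⁻¹ ≤ exp t`, which follows from `(1 + t) * (1 - t / 2) ≥ 1` on the unit
interval. -/
theorem sqrt_pi_div_le {t : ℝ} (h0 : 0 ≤ t) (h1 : t ≤ 1) :
    √(Real.pi / (1 / 2 - t / 4)) ≤ √(2 * Real.pi) * Real.exp (t / 2) := by
  have hp := Real.pi_pos
  rw [Real.sqrt_le_left (by positivity), mul_pow, Real.sq_sqrt (by positivity), ← Real.exp_nat_mul,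
    div_le_iff₀ (by linarith)]
  have h2 : t + 1 ≤ Real.exp ((2 : ℕ) * (t / 2)) := by
    rw [show ((2 : ℕ) : ℝ) * (t / 2) = t by push_cast; ring]
    exact Real.add_one_le_exp t
  have h3 : 1 ≤ Real.exp ((2 : ℕ) * (t / 2)) * (1 - t / 2) := by
    nlinarith [mul_le_mul_of_nonneg_right h2 (show 0 ≤ 1 - t / 2 by linarith)]
  nlinarith

/-! ### Exponential moments of random signs -/

/-- The sign `±1` of a boolean. -/
def boolSign (b : Bool) : ℝ := if b then 1 else -1

/-- Independence factors the sum into hyperbolic cosines, and `cosh a ≤ exp (a ^ 2 / 2)`. -/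
theorem sum_exp_boolSign_le {β : Type*} [Fintype β] [DecidableEq β] (a : β → ℝ) :
    ∑ σ : β → Bool, Real.exp (∑ e, a e * boolSign (σ e))
      ≤ 2 ^ Fintype.card β * Real.exp ((∑ e, a e ^ 2) / 2) := by
  calc ∑ σ : β → Bool, Real.exp (∑ e, a e * boolSign (σ e))
      = ∏ e, ∑ s : Bool, Real.exp (a e * boolSign s) := by
        rw [Fintype.prod_sum]
        simp only [Real.exp_sum]
    _ ≤ ∏ e : β, 2 * Real.exp (a e ^ 2 / 2) := by
        refine Finset.prod_le_prod (fun e _ => Finset.sum_nonneg fun _ _ => (Real.exp_pos _).le)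
          fun e _ => ?_
        have := Real.cosh_le_exp_half_sq (a e)
        rw [Real.cosh_eq] at this
        simp [boolSign]
        linarith
    _ = _ := by
        rw [Finset.prod_mul_distrib, Finset.prod_const, Finset.card_univ, ← Real.exp_sum,
          Finset.sum_div]

/-- Diagonalisation of a Gram matrix. -/
theorem exists_orthonormalBasis_sum_sq_eq {ι β : Type*} [Fintype ι] [Fintype β]
    (c : ι → β → ℝ) (h1 : ∀ x : ι → ℝ, ∑ e, (∑ i, x i * c i e) ^ 2 ≤ ∑ i, x i ^ 2) :
    ∃ (b : OrthonormalBasis ι ℝ (EuclideanSpace ℝ ι)) (κ : ι → ℝ), (∀ j, 0 ≤ κ j) ∧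
      (∀ j, κ j ≤ 1) ∧ ∑ j, κ j = ∑ i, ∑ e, c i e ^ 2 ∧
      ∀ x : EuclideanSpace ℝ ι, ∑ e, (∑ i, x i * c i e) ^ 2 = ∑ j, κ j * inner ℝ (b j) x ^ 2 := by
  classical
  let K : Matrix ι ι ℝ := Matrix.of c * (Matrix.of c).transpose
  have hK : K.IsHermitian := by
    have := Matrix.isHermitian_mul_conjTranspose_self (Matrix.of c)
    rwa [Matrix.conjTranspose_eq_transpose_of_trivial] at this
  set b := hK.eigenvectorBasis with hb
  set κ := hK.eigenvalues with hκdef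
  have hquad (x : EuclideanSpace ℝ ι) :
      ∑ e, (∑ i, x i * c i e) ^ 2 = ∑ j, κ j * inner ℝ (b j) x ^ 2 := by
    have hx : x = ∑ j, inner ℝ (b j) x • b j := (b.sum_repr' x).symm
    have hKx : K.mulVec x.ofLp = ∑ j, (κ j * inner ℝ (b j) x) • (b j).ofLp := by
      conv_lhs => rw [hx]
      simp only [WithLp.ofLp_sum, WithLp.ofLp_smul, Matrix.mulVec_sum, Matrix.mulVec_smul]
      refine Finset.sum_congr rfl fun j _ => ?_
      rw [hK.mulVec_eigenvectorBasis j, smul_smul, mul_comm]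
    have h2 : x.ofLp ⬝ᵥ K.mulVec x.ofLp = ∑ e, (∑ i, x i * c i e) ^ 2 := by
      rw [← Matrix.mulVec_mulVec, Matrix.dotProduct_mulVec, Matrix.mulVec_transpose]
      simp [dotProduct, Matrix.vecMul, sq]
    rw [← h2, hKx, dotProduct_sum]
    refine Finset.sum_congr rfl fun j _ => ?_
    rw [dotProduct_smul, smul_eq_mul, sq, ← mul_assoc]
    congr 1
  -- An eigenvalue is the value of the form at its unit eigenvector, so `h1` bounds it by 1.
  have hκ (j) : κ j = ∑ e, (∑ i, b j i * c i e) ^ 2 := by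
    rw [hquad, Finset.sum_eq_single j]
    · simp
    · intro k _ hk
      rw [orthonormal_iff_ite.1 b.orthonormal, if_neg hk]
      simp
    · simp
  have hκ0 (j) : 0 ≤ κ j := by
    rw [hκ]
    exact Finset.sum_nonneg fun _ _ => sq_nonneg _
  have hκ1 (j) : κ j ≤ 1 := by
    rw [hκ]
    refine (h1 _).trans_eq ?_
    rw [← EuclideanSpace.real_norm_sq_eq, b.orthonormal.1 j, one_pow]
  have htr : ∑ j, κ j = ∑ i, ∑ e, c i e ^ 2 := by
    have := hK.trace_eq_sum_eigenvalues
    simp only [RCLike.ofReal_real_eq_id, id] at this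
    rw [← this]
    simp [K, Matrix.trace, Matrix.mul_apply, sq]
  exact ⟨b, κ, hκ0, hκ1, htr, hquad⟩

/-- The exponential moment of a quadratic form in random signs. -/
theorem sum_exp_quadratic_boolSign_le {ι β : Type*} [Fintype ι] [Fintype β] [DecidableEq β]
    (c : ι → β → ℝ) (h1 : ∀ x : ι → ℝ, ∑ e, (∑ i, x i * c i e) ^ 2 ≤ ∑ i, x i ^ 2) :
    ∑ σ : β → Bool, Real.exp (1 / 4 * ∑ i, (∑ e, c i e * boolSign (σ e)) ^ 2)
      ≤ 2 ^ Fintype.card β * Real.exp ((∑ i, ∑ e, c i e ^ 2) / 2) := by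
  obtain ⟨b, κ, hκ0, hκ1, htr, hquad⟩ := exists_orthonormalBasis_sum_sq_eq c h1
  -- Gaussian linearisation: `exp (‖y‖ ^ 2 / 2)` is the normalised Gaussian integral of `exp ⟪y,
  -- x⟫`, whose exponent is linear in the signs. For fixed `x` the signs can be averaged out,
  -- leaving a Gaussian integral with spectrum `κ`. The factor `√(1 / 2)` produces the `1 / 4` of
  -- the statement.
  let y : (β → Bool) → EuclideanSpace ℝ ι := fun σ =>
    WithLp.toLp 2 fun i => √(1 / 2) * ∑ e, c i e * boolSign (σ e)
  have hs : √(1 / 2 : ℝ) ^ 2 = 1 / 2 := Real.sq_sqrt (by norm_num)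
  have hy (σ) : ‖y σ‖ ^ 2 / 2 = 1 / 4 * ∑ i, (∑ e, c i e * boolSign (σ e)) ^ 2 := by
    rw [EuclideanSpace.real_norm_sq_eq]
    simp only [y, mul_pow, hs, ← Finset.mul_sum]
    ring
  have hinner (σ) (x : EuclideanSpace ℝ ι) : inner ℝ (y σ) x
      = ∑ e, (√(1 / 2) * ∑ i, x i * c i e) * boolSign (σ e) := by
    simp only [y, PiLp.inner_apply, RCLike.inner_apply, conj_trivial, Finset.mul_sum,
      Finset.sum_mul]
    rw [Finset.sum_comm]
    exact Finset.sum_congr rfl fun e _ => Finset.sum_congr rfl fun i _ => by ring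
  have hZ : 0 < √(2 * Real.pi) ^ Fintype.card ι := by positivity
  refine le_of_mul_le_mul_left ?_ hZ
  calc √(2 * Real.pi) ^ Fintype.card ι
          * ∑ σ : β → Bool, Real.exp (1 / 4 * ∑ i, (∑ e, c i e * boolSign (σ e)) ^ 2)
      = ∫ x : EuclideanSpace ℝ ι, ∑ σ, Real.exp (-(‖x‖ ^ 2 / 2) + inner ℝ (y σ) x) := by
        rw [MeasureTheory.integral_finsetSum _ fun σ _ =>
          integrable_exp_neg_norm_sq_add_inner (y σ)]
        simp only [integral_exp_neg_norm_sq_add_inner, hy, ← Finset.mul_sum Finset.univ]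
    _ ≤ ∫ x : EuclideanSpace ℝ ι, 2 ^ Fintype.card β *
          Real.exp (-(‖x‖ ^ 2 / 2) + 1 / 4 * ∑ j, κ j * inner ℝ (b j) x ^ 2) := by
        refine MeasureTheory.integral_mono
          (MeasureTheory.integrable_finsetSum _ fun σ _ =>
            integrable_exp_neg_norm_sq_add_inner (y σ))
          ((integrable_gaussian_quadratic b fun j => by linarith [hκ1 j]).const_mul _) fun x => ?_
        simp only [Real.exp_add, ← Finset.mul_sum]
        rw [mul_left_comm]
        refine mul_le_mul_of_nonneg_left ?_ (Real.exp_pos _).le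
        simp only [hinner]
        refine (sum_exp_boolSign_le _).trans_eq ?_
        congr 2
        rw [← hquad]
        simp only [mul_pow, hs, ← Finset.mul_sum]
        ring
    _ = 2 ^ Fintype.card β * ∏ j, √(Real.pi / (1 / 2 - κ j / 4)) := by
        rw [MeasureTheory.integral_const_mul, integral_gaussian_quadratic]
    _ ≤ 2 ^ Fintype.card β * ∏ j, (√(2 * Real.pi) * Real.exp (κ j / 2)) := by
        gcongr with j
        exact sqrt_pi_div_le (hκ0 j) (hκ1 j)
    _ = _ := by
        rw [Finset.prod_mul_distrib, Finset.prod_const, Finset.card_univ, ← Real.exp_sum,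
          ← Finset.sum_div, htr]
        ring

/-! ### Rescaled POVM elements in Hilbert–Schmidt space -/

/-- The square of the Hilbert–Schmidt norm. -/
noncomputable def frobSq {d : ℕ} (A : Matrix (Fin d) (Fin d) ℂ) : ℝ :=
  ∑ p : Fin d × Fin d, ‖A p.1 p.2‖ ^ 2

theorem frobSq_nonneg {d : ℕ} (A : Matrix (Fin d) (Fin d) ℂ) : 0 ≤ frobSq A :=
  Finset.sum_nonneg fun _ _ => sq_nonneg _

theorem trace_mul_conjTranspose_self {d : ℕ} (A : Matrix (Fin d) (Fin d) ℂ) :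
    (A * A.conjTranspose).trace = (frobSq A : ℂ) := by
  simp [frobSq, Fintype.sum_prod_type, Matrix.trace, Matrix.mul_apply, Complex.mul_conj']

theorem trace_conjTranspose_mul_self {d : ℕ} (A : Matrix (Fin d) (Fin d) ℂ) :
    (A.conjTranspose * A).trace = (frobSq A : ℂ) := by
  rw [Matrix.trace_mul_comm, trace_mul_conjTranspose_self]

theorem norm_trace_conjTranspose_mul_sq_le {d : ℕ} (A B : Matrix (Fin d) (Fin d) ℂ) :
    ‖(A.conjTranspose * B).trace‖ ^ 2 ≤ frobSq A * frobSq B := by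
  have e : (A.conjTranspose * B).trace
      = ∑ p : Fin d × Fin d, star (A p.1 p.2) * B p.1 p.2 := by
    rw [Fintype.sum_prod_type, Finset.sum_comm]
    simp [Matrix.trace, Matrix.mul_apply]
  rw [e]
  calc ‖∑ p : Fin d × Fin d, star (A p.1 p.2) * B p.1 p.2‖ ^ 2
      ≤ (∑ p : Fin d × Fin d, ‖A p.1 p.2‖ * ‖B p.1 p.2‖) ^ 2 := by
        refine pow_le_pow_left₀ (norm_nonneg _) ((norm_sum_le _ _).trans_eq ?_) 2
        simp only [norm_mul, norm_star]
    _ ≤ _ := Finset.sum_mul_sq_le_sq_mul_sq _ _ _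

open scoped MatrixOrder in
theorem exists_conjTranspose_mul_self {d : ℕ} {M : Matrix (Fin d) (Fin d) ℂ}
    (hM : M.PosSemidef) : ∃ C : Matrix (Fin d) (Fin d) ℂ, M = C.conjTranspose * C :=
  CStarAlgebra.nonneg_iff_eq_star_mul_self.mp hM.nonneg

/-- Writing `M = Cᴴ C`, this is Cauchy–Schwarz for `C` and `C * A`. -/
theorem norm_trace_mul_sq_le {d : ℕ} {M : Matrix (Fin d) (Fin d) ℂ} (hM : M.PosSemidef)
    (A : Matrix (Fin d) (Fin d) ℂ) :
    ‖(M * A).trace‖ ^ 2 ≤ M.trace.re * (M * (A * A.conjTranspose)).trace.re := by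
  obtain ⟨C, rfl⟩ := exists_conjTranspose_mul_self hM
  have h1 : (C.conjTranspose * C * (A * A.conjTranspose)).trace = (frobSq (C * A) : ℂ) := by
    rw [← trace_mul_conjTranspose_self, Matrix.conjTranspose_mul, mul_assoc,
      Matrix.trace_mul_comm]
    simp only [mul_assoc]
  rw [h1, trace_conjTranspose_mul_self, Complex.ofReal_re, Complex.ofReal_re, mul_assoc]
  exact norm_trace_conjTranspose_mul_sq_le C (C * A)

theorem trace_re_nonneg {d : ℕ} {M : Matrix (Fin d) (Fin d) ℂ} (hM : M.PosSemidef) :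
    0 ≤ M.trace.re := (Complex.nonneg_iff.1 hM.trace_nonneg).1

theorem trace_mul_mul_conjTranspose_re_nonneg {d : ℕ} {M : Matrix (Fin d) (Fin d) ℂ}
    (hM : M.PosSemidef) (A : Matrix (Fin d) (Fin d) ℂ) :
    0 ≤ (M * (A * A.conjTranspose)).trace.re := by
  have h := trace_re_nonneg (hM.conjTranspose_mul_mul_same A)
  rwa [Matrix.trace_mul_comm, ← mul_assoc, Matrix.trace_mul_comm] at h

theorem frobSq_le_trace_sq {d : ℕ} {M : Matrix (Fin d) (Fin d) ℂ} (hM : M.PosSemidef) :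
    frobSq M ≤ M.trace.re ^ 2 := by
  obtain ⟨C, rfl⟩ := exists_conjTranspose_mul_self hM
  have hC : frobSq C = ∑ a, ∑ c, ‖C c a‖ ^ 2 := by
    rw [frobSq, Fintype.sum_prod_type, Finset.sum_comm]
  rw [trace_conjTranspose_mul_self, Complex.ofReal_re]
  calc frobSq (C.conjTranspose * C)
      ≤ ∑ p : Fin d × Fin d, (∑ c, ‖C c p.1‖ ^ 2) * ∑ c, ‖C c p.2‖ ^ 2 := by
        refine Finset.sum_le_sum fun p _ => ?_
        refine le_trans ?_ (Finset.sum_mul_sq_le_sq_mul_sq _ _ _)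
        refine pow_le_pow_left₀ (norm_nonneg _) ?_ 2
        rw [Matrix.mul_apply]
        refine (norm_sum_le _ _).trans_eq ?_
        simp
    _ = frobSq C ^ 2 := by
        rw [Fintype.sum_prod_type, hC, sq, Finset.sum_mul_sum]

/-- The rescaled POVM element `M_i / √(tr M_i)`. -/
noncomputable def POVM.normOp {d : ℕ} (M : POVM d) (i : Fin M.n) : Matrix (Fin d) (Fin d) ℂ :=
  (((√(M.op i).trace.re)⁻¹ : ℝ) : ℂ) • M.op i

theorem POVM.sqrt_smul_normOp {d : ℕ} (M : POVM d) (i : Fin M.n) :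
    ((√(M.op i).trace.re : ℝ) : ℂ) • M.normOp i = M.op i := by
  -- At zero trace the inverse in `normOp` defaults to 0; this is harmless, as a positive operator
  -- of zero trace vanishes.
  rcases (trace_re_nonneg (M.posSemidef i)).eq_or_lt with h | h
  · have h1 := frobSq_le_trace_sq (M.posSemidef i)
    rw [← h, zero_pow two_ne_zero] at h1
    have h2 := (Finset.sum_eq_zero_iff_of_nonneg fun p _ => sq_nonneg _).1
      (h1.antisymm (frobSq_nonneg _))
    have h3 : M.op i = 0 := by
      ext a b
      simpa using h2 (a, b) (Finset.mem_univ _)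
    simp [POVM.normOp, h3]
  · rw [POVM.normOp, smul_smul, ← Complex.ofReal_mul, mul_inv_cancel₀ (Real.sqrt_pos.2 h).ne',
      Complex.ofReal_one, one_smul]

theorem frobSq_smul {d : ℕ} (r : ℝ) (A : Matrix (Fin d) (Fin d) ℂ) :
    frobSq ((r : ℂ) • A) = r ^ 2 * frobSq A := by
  simp [frobSq, mul_pow, Finset.mul_sum]

theorem POVM.frobSq_normOp_le {d : ℕ} (M : POVM d) (i : Fin M.n) :
    frobSq (M.normOp i) ≤ (M.op i).trace.re := by
  have h0 := trace_re_nonneg (M.posSemidef i)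
  rw [POVM.normOp, frobSq_smul, inv_pow, Real.sq_sqrt h0]
  rcases h0.eq_or_lt with h | h
  · rw [← h]; simp
  · rw [inv_mul_le_iff₀ h, ← sq]
    exact frobSq_le_trace_sq (M.posSemidef i)

theorem POVM.sum_trace_re {d : ℕ} (M : POVM d) : ∑ i, (M.op i).trace.re = d := by
  rw [← Complex.re_sum, ← Matrix.trace_sum, M.sum_op]
  simp

/-- The right-hand side is linear in `M.op i`, so summing over the outcomes gives `frobSq A`. -/
theorem POVM.sq_re_trace_normOp_mul_le {d : ℕ} (M : POVM d) (i : Fin M.n)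
    (A : Matrix (Fin d) (Fin d) ℂ) :
    (M.normOp i * A).trace.re ^ 2 ≤ (M.op i * (A * A.conjTranspose)).trace.re := by
  have h0 := trace_re_nonneg (M.posSemidef i)
  have h1 : (M.normOp i * A).trace.re ^ 2 ≤ ‖(M.normOp i * A).trace‖ ^ 2 :=
    sq_le_sq' (by linarith [(abs_le.1 (Complex.abs_re_le_norm (M.normOp i * A).trace)).1])
      (Complex.re_le_norm _)
  refine h1.trans ?_
  rw [POVM.normOp, Matrix.smul_mul, Matrix.trace_smul, norm_smul, Complex.norm_real, mul_pow,
    Real.norm_eq_abs, sq_abs, inv_pow, Real.sq_sqrt h0]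
  rcases h0.eq_or_lt with h | h
  · rw [← h]
    simpa using trace_mul_mul_conjTranspose_re_nonneg (M.posSemidef i) A
  · rw [inv_mul_le_iff₀ h]
    exact norm_trace_mul_sq_le (M.posSemidef i) A

/-- The rescaled POVM elements form a contraction. -/
theorem POVM.frobSq_sum_smul_normOp_le {d : ℕ} (M : POVM d) (x : Fin M.n → ℝ) :
    frobSq (∑ i, (x i : ℂ) • M.normOp i) ≤ ∑ i, x i ^ 2 := by
  set A := ∑ i, (x i : ℂ) • M.normOp i with hA
  -- Duality: pairing `A` with itself reduces the claim to `h2`, where the elements sum to the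
  -- identity. Cauchy–Schwarz then leaves a factor `frobSq A` to cancel.
  have h1 : frobSq A = ∑ i, x i * (M.normOp i * A.conjTranspose).trace.re := by
    rw [← Complex.ofReal_re (frobSq A), ← trace_mul_conjTranspose_self]
    conv_lhs => rw [hA, Finset.sum_mul]
    rw [Matrix.trace_sum, Complex.re_sum]
    refine Finset.sum_congr rfl fun i _ => ?_
    rw [Matrix.smul_mul, Matrix.trace_smul, smul_eq_mul, Complex.re_ofReal_mul]
  have h2 : ∑ i, (M.normOp i * A.conjTranspose).trace.re ^ 2 ≤ frobSq A := by
    refine (Finset.sum_le_sum fun i _ => M.sq_re_trace_normOp_mul_le i A.conjTranspose).trans_eq ?_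
    rw [← Complex.re_sum, ← Matrix.trace_sum, ← Finset.sum_mul, M.sum_op, one_mul,
      Matrix.conjTranspose_conjTranspose, trace_conjTranspose_mul_self, Complex.ofReal_re]
  have h3 : frobSq A ^ 2 ≤ (∑ i, x i ^ 2) * frobSq A := by
    calc frobSq A ^ 2 ≤ (∑ i, x i ^ 2) * ∑ i, (M.normOp i * A.conjTranspose).trace.re ^ 2 := by
          rw [h1]
          exact Finset.sum_mul_sq_le_sq_mul_sq _ _ _
      _ ≤ _ := mul_le_mul_of_nonneg_left h2 (Finset.sum_nonneg fun _ _ => sq_nonneg _)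
  rcases (frobSq_nonneg A).eq_or_lt with h | h
  · rw [← h]
    exact Finset.sum_nonneg fun _ _ => sq_nonneg _
  · rw [sq] at h3
    exact le_of_mul_le_mul_right h3 h

/-! ### Measurement norms of random sign matrices -/

/-- The real symmetric matrix with prescribed signs. -/
noncomputable def signMatrix {d : ℕ} (σ : Sym2 (Fin d) → Bool) : Matrix (Fin d) (Fin d) ℂ :=
  Matrix.of fun a b => (boolSign (σ s(a, b)) : ℂ)

theorem signMatrix_isHermitian {d : ℕ} (σ : Sym2 (Fin d) → Bool) :
    (signMatrix σ).IsHermitian := by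
  ext a b
  simp [signMatrix, Sym2.eq_swap]

/-- The coefficients of `σ ↦ Re tr (B * signMatrix σ)`, up to the factor `√2`. -/
noncomputable def signCoeff {d : ℕ} (B : Matrix (Fin d) (Fin d) ℂ) (e : Sym2 (Fin d)) : ℝ :=
  √(1 / 2) * ∑ p : Fin d × Fin d with s(p.1, p.2) = e, (B p.1 p.2).re

theorem re_trace_mul_signMatrix {d : ℕ} (B : Matrix (Fin d) (Fin d) ℂ)
    (σ : Sym2 (Fin d) → Bool) :
    √(1 / 2) * (B * signMatrix σ).trace.re = ∑ e, signCoeff B e * boolSign (σ e) := by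
  have e1 : (B * signMatrix σ).trace.re
      = ∑ p : Fin d × Fin d, (B p.1 p.2).re * boolSign (σ s(p.1, p.2)) := by
    rw [Fintype.sum_prod_type, Matrix.trace, Complex.re_sum]
    refine Finset.sum_congr rfl fun a _ => ?_
    rw [Matrix.diag_apply, Matrix.mul_apply, Complex.re_sum]
    refine Finset.sum_congr rfl fun b _ => ?_
    rw [signMatrix, Matrix.of_apply, Complex.re_mul_ofReal, Sym2.eq_swap]
  rw [e1, ← Finset.sum_fiberwise Finset.univ fun p : Fin d × Fin d => s(p.1, p.2), Finset.mul_sum]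
  refine Finset.sum_congr rfl fun e _ => ?_
  rw [signCoeff, mul_assoc, Finset.sum_mul]
  congr 1
  refine Finset.sum_congr rfl fun p hp => ?_
  rw [(Finset.mem_filter.1 hp).2]

theorem card_filter_sym2_le_two {d : ℕ} (e : Sym2 (Fin d)) :
    (Finset.univ.filter fun p : Fin d × Fin d => s(p.1, p.2) = e).card ≤ 2 := by
  induction e with
  | _ a b =>
    refine (Finset.card_le_card fun p hp => ?_).trans (Finset.card_le_two (a := (a, b)) (b := (b, a)))
    have := (Finset.mem_filter.1 hp).2
    rw [Sym2.eq_iff] at this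
    simpa [Prod.ext_iff] using this

/-- At most two entries share one sign, and the factor `√(1 / 2)` exactly compensates the resulting
Cauchy–Schwarz loss. -/
theorem sum_signCoeff_sq_le {d : ℕ} (B : Matrix (Fin d) (Fin d) ℂ) :
    ∑ e, signCoeff B e ^ 2 ≤ frobSq B := by
  rw [frobSq, ← Finset.sum_fiberwise Finset.univ fun p : Fin d × Fin d => s(p.1, p.2)]
  refine Finset.sum_le_sum fun e _ => ?_
  rw [signCoeff, mul_pow, Real.sq_sqrt (by norm_num)]
  have h1 := sq_sum_le_card_mul_sum_sq
    (s := Finset.univ.filter fun p : Fin d × Fin d => s(p.1, p.2) = e)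
    (f := fun p => (B p.1 p.2).re)
  have h2 : ∑ p : Fin d × Fin d with s(p.1, p.2) = e, (B p.1 p.2).re ^ 2
      ≤ ∑ p : Fin d × Fin d with s(p.1, p.2) = e, ‖B p.1 p.2‖ ^ 2 :=
    Finset.sum_le_sum fun p _ => sq_le_sq.2 (by rw [abs_norm]; exact Complex.abs_re_le_norm _)
  have h3 : ((Finset.univ.filter fun p : Fin d × Fin d => s(p.1, p.2) = e).card : ℝ) ≤ 2 := by
    exact_mod_cast card_filter_sym2_le_two e
  have h4 : 0 ≤ ∑ p : Fin d × Fin d with s(p.1, p.2) = e, (B p.1 p.2).re ^ 2 :=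
    Finset.sum_nonneg fun _ _ => sq_nonneg _
  nlinarith

theorem sum_mul_signCoeff {d n : ℕ} (x : Fin n → ℝ) (B : Fin n → Matrix (Fin d) (Fin d) ℂ)
    (e : Sym2 (Fin d)) :
    ∑ i, x i * signCoeff (B i) e = signCoeff (∑ i, (x i : ℂ) • B i) e := by
  simp only [signCoeff, Matrix.sum_apply, Matrix.smul_apply, smul_eq_mul, Complex.re_sum,
    Complex.re_ofReal_mul]
  rw [Finset.sum_comm, Finset.mul_sum]
  refine Finset.sum_congr rfl fun i _ => ?_
  rw [← Finset.mul_sum, mul_left_comm]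

theorem norm_trace_mul_of_isHermitian {d : ℕ} {A B : Matrix (Fin d) (Fin d) ℂ}
    (hA : A.IsHermitian) (hB : B.IsHermitian) : ‖(A * B).trace‖ = |(A * B).trace.re| := by
  have h : star (A * B).trace = (A * B).trace := by
    rw [← Matrix.trace_conjTranspose, Matrix.conjTranspose_mul, hA.eq, hB.eq,
      Matrix.trace_mul_comm]
  rw [← Complex.conj_eq_iff_re.1 h, Complex.norm_real, Complex.ofReal_re, Real.norm_eq_abs]

/-- Cauchy–Schwarz with the weights `√(tr M_i)`, whose squares sum to `d`. -/
theorem POVM.measNorm_sq_le {d : ℕ} (M : POVM d) {Δ : Matrix (Fin d) (Fin d) ℂ}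
    (hΔ : Δ.IsHermitian) :
    M.measNorm Δ ^ 2 ≤ d * ∑ i, (M.normOp i * Δ).trace.re ^ 2 := by
  have h (i) : ‖(M.op i * Δ).trace‖ = √(M.op i).trace.re * |(M.normOp i * Δ).trace.re| := by
    rw [norm_trace_mul_of_isHermitian (M.posSemidef i).isHermitian hΔ]
    conv_lhs => rw [← M.sqrt_smul_normOp i]
    rw [Matrix.smul_mul, Matrix.trace_smul, smul_eq_mul, Complex.re_ofReal_mul, abs_mul,
      abs_of_nonneg (Real.sqrt_nonneg _)]
  rw [POVM.measNorm]
  simp only [h]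
  refine (Finset.sum_mul_sq_le_sq_mul_sq _ _ _).trans_eq ?_
  simp only [sq_abs, Real.sq_sqrt (trace_re_nonneg (M.posSemidef _)), M.sum_trace_re]

/-- Random sign matrices are sub-Gaussian for every measurement norm. -/
theorem POVM.sum_exp_measNorm_sq_le {d : ℕ} (hd : 1 ≤ d) (M : POVM d) :
    ∑ σ : Sym2 (Fin d) → Bool, Real.exp (M.measNorm (signMatrix σ) ^ 2 / (8 * d))
      ≤ 2 ^ Fintype.card (Sym2 (Fin d)) * Real.exp (d / 2) := by
  have hdR : (0 : ℝ) < d := by exact_mod_cast hd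
  have h1 (x : Fin M.n → ℝ) : ∑ e, (∑ i, x i * signCoeff (M.normOp i) e) ^ 2 ≤ ∑ i, x i ^ 2 := by
    simp only [sum_mul_signCoeff]
    exact (sum_signCoeff_sq_le _).trans (M.frobSq_sum_smul_normOp_le x)
  have h2 : ∑ i, ∑ e, signCoeff (M.normOp i) e ^ 2 ≤ d := by
    rw [← M.sum_trace_re]
    exact Finset.sum_le_sum fun i _ => (sum_signCoeff_sq_le _).trans (M.frobSq_normOp_le i)
  -- The 8 is 4 from the moment bound times 2 from the squared normalisation of `signCoeff`.
  calc ∑ σ : Sym2 (Fin d) → Bool, Real.exp (M.measNorm (signMatrix σ) ^ 2 / (8 * d))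
      ≤ ∑ σ : Sym2 (Fin d) → Bool,
          Real.exp (1 / 4 * ∑ i, (∑ e, signCoeff (M.normOp i) e * boolSign (σ e)) ^ 2) := by
        refine Finset.sum_le_sum fun σ _ => Real.exp_le_exp.2 ?_
        rw [div_le_iff₀ (by positivity)]
        refine (M.measNorm_sq_le (signMatrix_isHermitian σ)).trans_eq ?_
        simp only [← re_trace_mul_signMatrix, mul_pow, Real.sq_sqrt (show (0 : ℝ) ≤ 1 / 2 by
          norm_num), ← Finset.mul_sum]
        ring
    _ ≤ _ := sum_exp_quadratic_boolSign_le _ h1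
    _ ≤ _ := by gcongr

/-! ### Trace norm of random sign matrices -/

theorem trace_mul_self_eq_sum {d : ℕ} {Δ : Matrix (Fin d) (Fin d) ℂ} (h : Δ.IsHermitian) :
    (Δ * Δ).trace = ((∑ j, h.eigenvalues j ^ 2 : ℝ) : ℂ) := by
  calc (Δ * Δ).trace = (Δ * (Δ * ∑ j, eigProj h j)).trace := by rw [sum_eigProj, mul_one]
    _ = _ := by
      simp [Finset.mul_sum, mul_eigProj, Matrix.trace_sum, trace_eigProj, sq]

theorem trace_mul_self_mul_self_eq_sum {d : ℕ} {Δ : Matrix (Fin d) (Fin d) ℂ}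
    (h : Δ.IsHermitian) :
    (Δ * Δ * (Δ * Δ)).trace = ((∑ j, h.eigenvalues j ^ 4 : ℝ) : ℂ) := by
  calc (Δ * Δ * (Δ * Δ)).trace = (Δ * (Δ * (Δ * (Δ * ∑ j, eigProj h j)))).trace := by
        rw [sum_eigProj, mul_one, mul_assoc]
    _ = _ := by
      simp only [Finset.mul_sum, mul_eigProj, Matrix.trace_sum, Matrix.mul_smul, Matrix.trace_smul,
        trace_eigProj, smul_eq_mul, mul_one]
      push_cast
      exact Finset.sum_congr rfl fun j _ => by ring

/-- An even quartic below `a ^ 3 * |x|`; the coefficient `4 / 27` makes it touch at `|x| = 3 * a /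
2`. -/
theorem sq_mul_sq_sub_le {a : ℝ} (ha : 0 ≤ a) (x : ℝ) :
    a ^ 2 * x ^ 2 - 4 / 27 * x ^ 4 ≤ a ^ 3 * |x| := by
  have hx := abs_nonneg x
  have e : a ^ 3 * |x| - (a ^ 2 * |x| ^ 2 - 4 / 27 * |x| ^ 4)
      = |x| * ((a - 2 / 3 * |x|) ^ 2 * (a + |x| / 3)) := by ring
  have h4 : x ^ 4 = |x| ^ 4 := by rw [← Even.pow_abs (by decide)]
  rw [h4, ← sq_abs x]
  have : 0 ≤ |x| * ((a - 2 / 3 * |x|) ^ 2 * (a + |x| / 3)) := by positivity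
  linarith

/-- The trace norm is bounded below by the second and fourth moments of the spectrum. -/
theorem sq_mul_trace_sub_le_hermTraceNorm {d : ℕ} {Δ : Matrix (Fin d) (Fin d) ℂ}
    (h : Δ.IsHermitian) {a : ℝ} (ha : 0 ≤ a) :
    a ^ 2 * (Δ * Δ).trace.re - 4 / 27 * (Δ * Δ * (Δ * Δ)).trace.re ≤ a ^ 3 * hermTraceNorm h := by
  rw [trace_mul_self_eq_sum h, trace_mul_self_mul_self_eq_sum h, Complex.ofReal_re,
    Complex.ofReal_re, hermTraceNorm, Finset.mul_sum, Finset.mul_sum, Finset.mul_sum,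
    ← Finset.sum_sub_distrib]
  exact Finset.sum_le_sum fun j _ => sq_mul_sq_sub_le ha _

theorem boolSign_mul_self (b : Bool) : boolSign b * boolSign b = 1 := by
  cases b <;> simp [boolSign]

theorem abs_boolSign (b : Bool) : |boolSign b| = 1 := by
  cases b <;> simp [boolSign]

theorem boolSign_not (b : Bool) : boolSign (!b) = -boolSign b := by
  cases b <;> simp [boolSign]

theorem trace_signMatrix_mul_self {d : ℕ} (σ : Sym2 (Fin d) → Bool) :
    (signMatrix σ * signMatrix σ).trace.re = (d : ℝ) ^ 2 := by
  have h : (signMatrix σ * signMatrix σ).trace = ((d : ℝ) ^ 2 : ℝ) := by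
    have e (a b : Fin d) : signMatrix σ a b * signMatrix σ b a = 1 := by
      rw [signMatrix, Matrix.of_apply, Matrix.of_apply, Sym2.eq_swap, ← Complex.ofReal_mul,
        boolSign_mul_self, Complex.ofReal_one]
    simp [Matrix.trace, Matrix.mul_apply, e, sq]
  rw [h, Complex.ofReal_re]

theorem trace_signMatrix_fourth {d : ℕ} (σ : Sym2 (Fin d) → Bool) :
    (signMatrix σ * signMatrix σ * (signMatrix σ * signMatrix σ)).trace.re
      = ∑ i, ∑ k, ∑ j, ∑ l, boolSign (σ s(i, j)) * (boolSign (σ s(j, k)) *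
          (boolSign (σ s(k, l)) * boolSign (σ s(l, i)))) := by
  rw [← Complex.ofReal_re (∑ i, _)]
  congr 1
  simp only [Matrix.trace, Matrix.diag_apply, Matrix.mul_apply, Finset.sum_mul_sum, signMatrix,
    Matrix.of_apply]
  push_cast
  simp only [mul_assoc]

/-- Flipping the sign at `e₁` is an involution that negates every term. -/
theorem sum_boolSign_mul_eq_zero {β : Type*} [Fintype β] [DecidableEq β] {e₁ e₂ e₃ e₄ : β}
    (h2 : e₂ ≠ e₁) (h3 : e₃ ≠ e₁) (h4 : e₄ ≠ e₁) :
    ∑ σ : β → Bool, boolSign (σ e₁) * (boolSign (σ e₂) * (boolSign (σ e₃) * boolSign (σ e₄)))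
      = 0 := by
  refine Finset.sum_involution (fun σ _ => Function.update σ e₁ (!σ e₁)) (fun σ _ => ?_)
    (fun σ _ _ hσ => ?_) (fun _ _ => Finset.mem_univ _) (fun σ _ => ?_)
  · simp [Function.update_of_ne, h2, h3, h4, boolSign_not]
  · have := congrFun hσ e₁
    simp at this
  · simp

theorem sum_boolSign_mul_le {β : Type*} [Fintype β] [DecidableEq β] (e₁ e₂ e₃ e₄ : β) :
    ∑ σ : β → Bool, boolSign (σ e₁) * (boolSign (σ e₂) * (boolSign (σ e₃) * boolSign (σ e₄)))
      ≤ 2 ^ Fintype.card β := by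
  refine (Finset.sum_le_card_nsmul _ _ 1 fun σ _ => ?_).trans_eq (by simp)
  refine (le_abs_self _).trans_eq ?_
  simp [abs_mul, abs_boolSign]

/-- A closed walk `i, j, k, l` contributes only if its first edge is repeated, which forces one of
the three listed coincidences. These account for at most `2 * d ^ 3 + d ^ 2` walks. -/
theorem sum_boolSign_cycle_le {d : ℕ} (i k j l : Fin d) :
    ∑ σ : Sym2 (Fin d) → Bool, boolSign (σ s(i, j)) * (boolSign (σ s(j, k)) *
        (boolSign (σ s(k, l)) * boolSign (σ s(l, i))))
      ≤ 2 ^ Fintype.card (Sym2 (Fin d)) * ((if i = k then 1 else 0) + (if j = l then 1 else 0)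
        + (if i = l then (if j = k then 1 else 0) else 0)) := by
  by_cases h : i = k ∨ j = l ∨ (i = l ∧ j = k)
  · refine (sum_boolSign_mul_le _ _ _ _).trans (le_mul_of_one_le_right (by positivity) ?_)
    rcases h with rfl | rfl | ⟨rfl, rfl⟩
    · rw [if_pos rfl]; split_ifs <;> norm_num
    · rw [if_pos (rfl : j = j)]; split_ifs <;> norm_num
    · rw [if_pos (rfl : i = i), if_pos (rfl : j = j)]; split_ifs <;> norm_num
  · push Not at h
    obtain ⟨h1, h2, h3⟩ := h
    rw [sum_boolSign_mul_eq_zero]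
    · have : (0 : ℝ) ≤ (if i = k then 1 else 0) + (if j = l then 1 else 0)
        + (if i = l then (if j = k then 1 else 0) else 0) := by split_ifs <;> norm_num
      positivity
    all_goals rw [Ne, Sym2.eq_iff]; grind

theorem sum_trace_signMatrix_fourth_le {d : ℕ} (hd : 1 ≤ d) :
    ∑ σ : Sym2 (Fin d) → Bool,
        (signMatrix σ * signMatrix σ * (signMatrix σ * signMatrix σ)).trace.re
      ≤ 2 ^ Fintype.card (Sym2 (Fin d)) * (3 * (d : ℝ) ^ 3) := by
  have hdR : (1 : ℝ) ≤ d := by exact_mod_cast hd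
  simp only [trace_signMatrix_fourth]
  rw [Finset.sum_comm]
  simp_rw [Finset.sum_comm (s := (Finset.univ : Finset (Sym2 (Fin d) → Bool)))]
  calc _ ≤ ∑ i : Fin d, ∑ k : Fin d, ∑ j : Fin d, ∑ l : Fin d,
        (2 : ℝ) ^ Fintype.card (Sym2 (Fin d)) * ((if i = k then 1 else 0)
          + (if j = l then 1 else 0) + (if i = l then (if j = k then 1 else 0) else 0)) :=
        Finset.sum_le_sum fun i _ => Finset.sum_le_sum fun k _ => Finset.sum_le_sum fun j _ =>
          Finset.sum_le_sum fun l _ => sum_boolSign_cycle_le i k j l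
    _ = 2 ^ Fintype.card (Sym2 (Fin d)) * (2 * (d : ℝ) ^ 3 + (d : ℝ) ^ 2) := by
        simp only [← Finset.mul_sum]
        congr 1
        simp [Finset.sum_add_distrib]
        ring
    _ ≤ _ := by
        gcongr
        nlinarith [mul_le_mul_of_nonneg_left hdR (sq_nonneg (d : ℝ))]

/-- The average trace norm of a random sign matrix is of order `d ^ (3 / 2)`. -/
theorem sum_hermTraceNorm_signMatrix_ge {d : ℕ} (hd : 1 ≤ d) :
    2 ^ Fintype.card (Sym2 (Fin d)) * (d * √d / 2) ≤
      ∑ σ : Sym2 (Fin d) → Bool, hermTraceNorm (signMatrix_isHermitian σ) := by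
  have hdR : (0 : ℝ) < d := by exact_mod_cast hd
  have hs : 0 < √(d : ℝ) := Real.sqrt_pos.2 hdR
  have hsq : √(d : ℝ) ^ 2 = d := Real.sq_sqrt hdR.le
  -- The choice `a = √d` is the eigenvalue scale: the second moment yields `d ^ 3`, the fourth costs
  -- at most `4 / 9 * d ^ 3`, and the remainder exceeds `d ^ 3 / 2`.
  have h1 := Finset.sum_le_sum fun (σ : Sym2 (Fin d) → Bool) (_ : σ ∈ Finset.univ) =>
    sq_mul_trace_sub_le_hermTraceNorm (signMatrix_isHermitian σ) hs.le
  rw [Finset.sum_sub_distrib, ← Finset.mul_sum, ← Finset.mul_sum, ← Finset.mul_sum] at h1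
  simp only [trace_signMatrix_mul_self, Finset.sum_const, Finset.card_univ, Fintype.card_fun,
    Fintype.card_bool, nsmul_eq_mul, Nat.cast_pow, Nat.cast_ofNat, hsq] at h1
  have h2 := sum_trace_signMatrix_fourth_le hd
  set N : ℝ := 2 ^ Fintype.card (Sym2 (Fin d))
  have hN : 0 < N := by positivity
  have hc : √(d : ℝ) ^ 3 = d * √d := by rw [pow_succ, hsq]
  rw [hc] at h1
  refine le_of_mul_le_mul_left ?_ (mul_pos hdR hs)
  refine le_trans ?_ h1
  have e : d * √d * (N * (d * √d / 2)) = N * (d : ℝ) ^ 3 / 2 := by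
    calc d * √d * (N * (d * √d / 2)) = N * (d : ℝ) ^ 2 * √(d : ℝ) ^ 2 / 2 := by ring
      _ = _ := by rw [hsq]; ring
  rw [e]
  have hp : 0 < N * (d : ℝ) ^ 3 := by positivity
  nlinarith

/-! ### Part (ii): the cardinality bound -/

/-- Jensen's inequality, from the tangent line of the exponential at `m`. -/
theorem card_mul_exp_le_sum_exp {α : Type*} [Fintype α] {x : α → ℝ} {m : ℝ}
    (h : Fintype.card α * m ≤ ∑ a, x a) :
    Fintype.card α * Real.exp m ≤ ∑ a, Real.exp (x a) := by
  have h1 : ∀ a, Real.exp m * (1 + (x a - m)) ≤ Real.exp (x a) := by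
    intro a
    have e : Real.exp (x a) = Real.exp m * Real.exp (x a - m) := by rw [← Real.exp_add]; ring_nf
    rw [e]
    have := Real.add_one_le_exp (x a - m)
    gcongr
    linarith
  refine le_trans ?_ (Finset.sum_le_sum fun a _ => h1 a)
  rw [← Finset.mul_sum, Finset.sum_add_distrib, Finset.sum_sub_distrib]
  simp only [Finset.sum_const, Finset.card_univ, nsmul_eq_mul, mul_one]
  nlinarith [Real.exp_pos m]

/-- A finite family of POVMs which is good for all sign matrices is large. -/
theorem exp_le_card_of_forall_signMatrix {d : ℕ} (hd : 1 ≤ d) {ε : ℝ} (hε : 0 ≤ ε)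
    (F : Finset (POVM d)) (hF : ∀ σ : Sym2 (Fin d) → Bool, ∃ M ∈ F,
      ε * hermTraceNorm (signMatrix_isHermitian σ) ≤ M.measNorm (signMatrix σ)) :
    Real.exp (ε ^ 2 * (d : ℝ) ^ 2 / 32) ≤ F.card * Real.exp (d / 2) := by
  have hdR : (0 : ℝ) < d := by exact_mod_cast hd
  have hsq : √(d : ℝ) ^ 2 = d := Real.sq_sqrt hdR.le
  set T : (Sym2 (Fin d) → Bool) → ℝ := fun σ => hermTraceNorm (signMatrix_isHermitian σ) with hT
  have hT0 : ∀ σ, 0 ≤ T σ := fun σ => hermTraceNorm_nonneg _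
  have hcard : (Fintype.card (Sym2 (Fin d) → Bool) : ℝ) = 2 ^ Fintype.card (Sym2 (Fin d)) := by
    simp
  have hN : (0 : ℝ) < 2 ^ Fintype.card (Sym2 (Fin d)) := by positivity
  have hsum : (2 : ℝ) ^ Fintype.card (Sym2 (Fin d)) * (d * √d / 2) ≤ ∑ σ, T σ :=
    sum_hermTraceNorm_signMatrix_ge hd
  have hlow : (2 : ℝ) ^ Fintype.card (Sym2 (Fin d)) * Real.exp (ε ^ 2 * (d : ℝ) ^ 2 / 32)
      ≤ ∑ σ, Real.exp ((ε * T σ) ^ 2 / (8 * d)) := by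
    rw [← hcard]
    refine card_mul_exp_le_sum_exp ?_
    rw [hcard]
    set f := d * √d / 2 with hf
    have hf0 : 0 ≤ f := by positivity
    have hf2 : f ^ 2 = (d : ℝ) ^ 3 / 4 := by rw [hf, div_pow, mul_pow, hsq]; ring
    -- The tangent to the square at `f` means that only the first moment of `T` is needed.
    have hpt : ∀ σ, ε ^ 2 / (8 * d) * (2 * f * T σ - f ^ 2) ≤ (ε * T σ) ^ 2 / (8 * d) := by
      intro σ
      rw [mul_pow, mul_div_right_comm]
      gcongr
      nlinarith [sq_nonneg (T σ - f)]
    refine le_trans ?_ (Finset.sum_le_sum fun σ _ => hpt σ)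
    rw [← Finset.mul_sum, Finset.sum_sub_distrib, ← Finset.mul_sum, Finset.sum_const,
      Finset.card_univ, nsmul_eq_mul, hcard]
    have h1 : (2 : ℝ) ^ Fintype.card (Sym2 (Fin d)) * f ^ 2
        ≤ 2 * f * ∑ σ, T σ - 2 ^ Fintype.card (Sym2 (Fin d)) * f ^ 2 := by
      nlinarith [mul_le_mul_of_nonneg_left hsum hf0]
    calc (2 : ℝ) ^ Fintype.card (Sym2 (Fin d)) * (ε ^ 2 * (d : ℝ) ^ 2 / 32)
        = ε ^ 2 / (8 * d) * (2 ^ Fintype.card (Sym2 (Fin d)) * f ^ 2) := by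
          rw [hf2]; field_simp; ring
      _ ≤ _ := by gcongr
  have hup : ∑ σ, Real.exp ((ε * T σ) ^ 2 / (8 * d))
      ≤ F.card * (2 ^ Fintype.card (Sym2 (Fin d)) * Real.exp (d / 2)) := by
    calc ∑ σ, Real.exp ((ε * T σ) ^ 2 / (8 * d))
        ≤ ∑ σ, ∑ M ∈ F, Real.exp (M.measNorm (signMatrix σ) ^ 2 / (8 * d)) := by
          refine Finset.sum_le_sum fun σ _ => ?_
          obtain ⟨M, hM, h⟩ := hF σ
          refine le_trans ?_ (Finset.single_le_sum
            (f := fun M : POVM d => Real.exp (M.measNorm (signMatrix σ) ^ 2 / (8 * d)))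
            (fun _ _ => (Real.exp_pos _).le) hM)
          have := mul_nonneg hε (hT0 σ)
          gcongr
      _ ≤ ∑ M ∈ F, (2 ^ Fintype.card (Sym2 (Fin d)) * Real.exp (d / 2)) := by
          rw [Finset.sum_comm]
          exact Finset.sum_le_sum fun M _ => M.sum_exp_measNorm_sq_le hd
      _ = _ := by rw [Finset.sum_const, nsmul_eq_mul]
  refine le_of_mul_le_mul_left ((hlow.trans hup).trans_eq ?_) hN
  ring

theorem allNorm_one_pos {d : ℕ} (hd : 1 ≤ d) :
    0 < allNorm (1 : Matrix (Fin d) (Fin d) ℂ) := by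
  have hdR : (0 : ℝ) < d := by exact_mod_cast hd
  rw [allNorm_eq_hermTraceNorm Matrix.isHermitian_one]
  have h := trace_eq_ofReal_sum_eigenvalues (Matrix.isHermitian_one (n := Fin d) (α := ℂ))
  have h0 : ((d : ℝ) : ℂ) = (1 : Matrix (Fin d) (Fin d) ℂ).trace := by simp
  have h1 := h0.trans h
  rw [Complex.ofReal_inj] at h1
  exact hdR.trans_le (h1.le.trans (Finset.sum_le_sum fun j _ => le_abs_self _))

theorem nonempty_of_forall_le_distNorm {d : ℕ} (hd : 1 ≤ d) {ε : ℝ} (hε : 0 < ε)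
    {S : Set (POVM d)} (hS : ∀ Δ : Matrix (Fin d) (Fin d) ℂ, Δ.IsHermitian →
      ε * allNorm Δ ≤ distNorm S Δ) : S.Nonempty := by
  by_contra h
  rw [Set.not_nonempty_iff_eq_empty] at h
  have h1 := hS 1 Matrix.isHermitian_one
  rw [h, distNorm, Set.image_empty, Real.sSup_empty] at h1
  exact absurd h1 (not_le.2 (mul_pos hε (allNorm_one_pos hd)))

/-- A family of POVMs distinguishing all pairs of states well is large. -/
theorem exists_finset_card_ge_of_forall_le_distNorm {d : ℕ} (hd : 1 ≤ d) {ε : ℝ}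
    (hε : 48 / √d < ε) {S : Set (POVM d)} (hS : ∀ Δ : Matrix (Fin d) (Fin d) ℂ, Δ.IsHermitian →
      ε * allNorm Δ ≤ distNorm S Δ) :
    ∃ F : Finset (POVM d), (F : Set (POVM d)) ⊆ S ∧
      Real.exp (1 / 64 * ε ^ 2 * (d : ℝ) ^ 2) ≤ (F.card : ℝ) := by
  have hdR : (0 : ℝ) < d := by exact_mod_cast hd
  have hs : 0 < √(d : ℝ) := Real.sqrt_pos.2 hdR
  have hsq : √(d : ℝ) ^ 2 = d := Real.sq_sqrt hdR.le
  have hε0 : 0 < ε := lt_trans (by positivity) hε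
  -- For finite nonempty `S` the supremum is attained, so each sign matrix is served by one member.
  -- An infinite `S` has finite subsets of every size.
  by_cases hfin : S.Finite
  · refine ⟨hfin.toFinset, by simp, ?_⟩
    have h := exp_le_card_of_forall_signMatrix hd hε0.le hfin.toFinset fun σ => by
      have hmem := ((nonempty_of_forall_le_distNorm hd hε0 hS).image
        fun M : POVM d => M.measNorm (signMatrix σ)).csSup_mem (hfin.image _)
      obtain ⟨M, hM, hMeq⟩ := hmem
      refine ⟨M, hfin.mem_toFinset.2 hM, ?_⟩
      rw [← allNorm_eq_hermTraceNorm]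
      exact (hS _ (signMatrix_isHermitian σ)).trans_eq hMeq.symm
    rw [← div_le_iff₀ (Real.exp_pos _), ← Real.exp_sub] at h
    refine le_trans (Real.exp_le_exp.2 ?_) h
    -- Here `ε ^ 2 * d ≥ 32` would do, to make `d / 2` at most half of `ε ^ 2 * d ^ 2 / 32`; the
    -- value 48 is the constant shared with part (i).
    have h1 : 48 < ε * √d := by rwa [div_lt_iff₀ hs] at hε
    have h2 : 48 ^ 2 < (ε * √d) ^ 2 := pow_lt_pow_left₀ h1 (by norm_num) two_ne_zero
    rw [mul_pow, hsq] at h2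
    nlinarith [mul_lt_mul_of_pos_right h2 hdR]
  · obtain ⟨n, hn⟩ := exists_nat_ge (Real.exp (1 / 64 * ε ^ 2 * (d : ℝ) ^ 2))
    obtain ⟨F, hF, hFn⟩ := Set.Infinite.exists_subset_card_eq hfin n
    exact ⟨F, hF, by rwa [hFn]⟩

theorem theorem1 :
    ∃ c C : ℝ, 0 < c ∧ 0 < C ∧
      (∀ d : ℕ, 1 ≤ d → ∀ ε : ℝ, 0 < ε → ε < 1 →
        ∃ F : Finset (POVM d),
          (F.card : ℝ) ≤ Real.exp (C * |Real.log ε| * (d : ℝ) ^ 2) ∧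
          ∀ Δ : Matrix (Fin d) (Fin d) ℂ, Δ.IsHermitian →
            (1 - ε) * allNorm Δ ≤ distNorm (F : Set (POVM d)) Δ) ∧
      (∀ d : ℕ, 1 ≤ d → ∀ ε : ℝ, C / Real.sqrt d < ε →
        ∀ S : Set (POVM d),
          (∀ Δ : Matrix (Fin d) (Fin d) ℂ, Δ.IsHermitian →
            ε * allNorm Δ ≤ distNorm S Δ) →
          ∃ F : Finset (POVM d), (F : Set (POVM d)) ⊆ S ∧
            Real.exp (c * ε ^ 2 * (d : ℝ) ^ 2) ≤ (F.card : ℝ)) := by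
  refine ⟨1 / 64, 48, by norm_num, by norm_num, fun d hd ε h0 h1 => ?_, fun d hd ε hε S hS =>
    exists_finset_card_ge_of_forall_le_distNorm hd hε hS⟩
  obtain ⟨F, hF, hM⟩ := exists_finset_povm_approx hd h0 h1
  refine ⟨F, hF, fun Δ h => ?_⟩
  obtain ⟨M, hMF, hMΔ⟩ := hM Δ h
  rw [allNorm_eq_hermTraceNorm h]
  exact hMΔ.trans (le_distNorm_of_mem hMF h)
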